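/- A probabilistic basic parallel process (pBPP) consists of a finite set $\Gamma$ of types, a finite set of rules $X \hookrightarrow \beta$ with $X \in \Gamma$, $\beta \in \mathbb{N}^\Gamma$, and for every rule a rational probability in $(0,1]$, such that for every $X \in \Gamma$ the probabilities of the rules with left-hand side $X$ sum to $1$. A configuration is an element of $\mathbb{N}^\Gamma$; $X$ also denotes the configuration with exactly one process, of type $X$; and $\varepsilon$ is the empty configuration. Scheduling a type $X$ in a configuration $\alpha$ with $\alpha(X) \ge 1$ leads to $\alpha - X + \beta$ with the probability of the rule $X \hookrightarrow \beta$. In the Markov chain with measure $\mathbb{P}_{type}$ the type to be scheduled is picked uniformly among the types $X$ with $\alpha(X) \ge 1$, in the Markov chain with measure $\mathbb{P}_{proc}$ type $X$ is picked with probability $\alpha(X)/\sum_Y \alpha(Y)$; in both, $\varepsilon$ is absorbing. In the Markov decision process (MDP) of the pBPP, a history-dependent randomised scheduler $\sigma$ picks the type, among those with $\alpha(X)\ge 1$ (in $\varepsilon$ only an idle action is available); $\mathbb{P}_\sigma$ is the resulting measure. A run $\alpha_0 a_1 \alpha_1 a_2 \cdots$ of the MDP is $k$-fair if for all $i \ge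 0$ and all $X \in \Gamma$ with $\alpha_i(X) \ge 1$ we have $X \in \{a_{i+1}, \ldots, a_{i+k}\}$. A scheduler is $k$-fair if all runs that it produces (runs all of whose steps have positive probability) are $k$-fair. For $Q \subseteq \Gamma$, the $Q$-states set is $F_Q = \bigcup_{X \in Q} \{\beta \in \mathbb{N}^\Gamma \mid \beta(X) \ge 1\}$, and $\alpha_0 \models \Diamond F$ is the event that a run started in $\alpha_0$ hits $F$. **Theorem.** (a) Given a pBPP, a set $Q \subseteq \Gamma$ and $\alpha_0 \in \mathbb{N}^\Gamma$ (all numbers encoded in binary), it is decidable in polynomial time whether $\mathbb{P}_{type}(\alpha_0 \models \Diamond F_Q) = 1$, and likewise whether $\mathbb{P}_{proc}(\alpha_0 \models \Diamond F_Q) = 1$. (b) For every pBPP, every $Q \subseteq \Gamma$, every $\alpha_0 \in \mathbb{N}^\Gamma$ and every $k \ge |\Gamma|$, the following are equivalent: (i) $\mathbb{P}_{type}(\alpha_0 \models \Diamond F_Q) = 1$; (ii) $\mathbb{P}_{proc}(\alpha_0 \models \Diamond F_Q) = 1$; (iii) $\mathbb{P}_\sigma(\alpha_0 \models \Diamond F_Q)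 = 1$ for some scheduler $\sigma$; (iv) $\mathbb{P}_\sigma(\alpha_0 \models \Diamond F_Q) = 1$ for all $k$-fair schedulers $\sigma$. Consequently, the existential problem (given a pBPP, $Q$ and $\alpha_0$, does (iii) hold?) and the $k$-fair universal problem (given a pBPP, $Q$, $\alpha_0$ and $k \ge |\Gamma|$, does (iv) hold?) are decidable in polynomial time. -/

import Mathlib

open MeasureTheory ProbabilityTheory
open scoped ENNReal

universe u

noncomputable section

namespace PBPP

/-! ### Random infinite sequences with a history-dependent transition law -/

section

variable {X : Type u} [Countable X] [MeasurableSpace X] [DiscreteMeasurableSpace X]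

/-- The conditional law of `xₙ₊₁` given `x₀, …, xₙ`, when it is `next [x₀, …, xₙ₋₁] xₙ`. -/
def seqKernel (next : List X → X → PMF X) (n : ℕ) :
    Kernel ((i : Finset.Iic n) → (fun _ : ℕ => X) i) ((fun _ : ℕ => X) (n + 1)) :=
  Kernel.ofFunOfCountable fun x : ((i : Finset.Iic n) → X) =>
    (next (List.ofFn fun i : Fin n => x ⟨i, Finset.mem_Iic.2 i.2.le⟩)
      (x ⟨n, Finset.mem_Iic.2 le_rfl⟩)).toMeasure

instance (next : List X → X → PMF X) (n : ℕ) : IsMarkovKernel (seqKernel next n) :=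
  ⟨fun _ => PMF.toMeasure.isProbabilityMeasure _⟩

/-- The law of a random sequence `x₀ x₁ x₂ …` over a countable set, where `x₀` is drawn from `init`
and `xₙ₊₁` is drawn from `next [x₀, …, xₙ₋₁] xₙ`. -/
def seqLaw (init : PMF X) (next : List X → X → PMF X) : Measure (ℕ → X) :=
  Kernel.trajMeasure (X := fun _ => X) init.toMeasure (seqKernel next)

end

/-- `markovProb δ s₀ F` is the probability that the Markov chain with transition function `δ`
started in `s₀` hits `F`. -/
def markovProb {S : Type u} [Countable S] [MeasurableSpace S] [DiscreteMeasurableSpace S]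
    (δ : S → PMF S) (s₀ : S) (F : Set S) : ℝ≥0∞ :=
  seqLaw (PMF.pure s₀) (fun _ s => δ s) {run | ∃ i, run i ∈ F}

/-! ### Markov decision processes -/

/-- A Markov decision process with states `S` and actions `A`. The values `δ s a` for actions `a`
that are not enabled in `s` play no role. -/
structure MDP (S A : Type u) where
  En : S → Set A
  En_nonempty : ∀ s, (En s).Nonempty
  δ : S → A → PMF S

namespace MDP

variable {S A : Type u} (D : MDP S A)

/-- A (history-dependent, randomised) scheduler. The run prefix `s₀ a₁ s₁ … aₖ sₖ` is
represented by the list `[(s₀, a₁), …, (sₖ₋₁, aₖ)]` together with the state `sₖ`. -/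
structure Scheduler where
  choose : List (S × A) → S → PMF A
  enabled : ∀ h s a, choose h s a ≠ 0 → a ∈ D.En s

variable {D}

/-- The law of the run `s₀ a₁ s₁ a₂ …` under `σ`, given as the sequence
`(s₀, a₁), (s₁, a₂), …`. -/
def Scheduler.runLaw [Countable S] [MeasurableSpace S] [DiscreteMeasurableSpace S]
    [Countable A] [MeasurableSpace A] [DiscreteMeasurableSpace A]
    (σ : D.Scheduler) (s₀ : S) : Measure (ℕ → S × A) :=
  seqLaw ((σ.choose [] s₀).map (Prod.mk s₀)) fun h sa =>
    (D.δ sa.1 sa.2).bind fun t => (σ.choose (h ++ [sa]) t).map (Prod.mk t)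

/-- The probability that the run started in `s₀` under the scheduler `σ` hits `F`. -/
def Scheduler.prob [Countable S] [MeasurableSpace S] [DiscreteMeasurableSpace S]
    [Countable A] [MeasurableSpace A] [DiscreteMeasurableSpace A]
    (σ : D.Scheduler) (s₀ : S) (F : Set S) : ℝ≥0∞ :=
  σ.runLaw s₀ {run | ∃ i, (run i).1 ∈ F}

/-- The run `s₀ a₁ s₁ a₂ …`, given as the sequence `(s₀, a₁), (s₁, a₂), …`, can be produced
by the scheduler `σ`: each of its steps has positive probability. -/
def Scheduler.Produces (σ : D.Scheduler) (run : ℕ → S × A) : Prop :=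
  ∀ i, σ.choose (List.ofFn fun j : Fin i => run j) (run i).1 (run i).2 ≠ 0 ∧
    D.δ (run i).1 (run i).2 (run (i + 1)).1 ≠ 0

end MDP

/-! ### Probabilistic basic parallel processes -/

/-- Configurations over the set of types `Γ`. -/
abbrev Config (Γ : Type u) : Type u := Γ → ℕ

end PBPP

open PBPP in
/-- A probabilistic basic parallel process over the set of types `Γ`: `rules X` is the finite set
of all `β` such that there is a rule `X ⟶ β`, and `prob X β` is the probability of this rule,
extended by `0` to all `β`. -/
structure PBPP (Γ : Type u) where
  rules : Γ → Finset (Config Γ)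
  prob : Γ → Config Γ → ℚ
  prob_pos : ∀ X, ∀ β ∈ rules X, 0 < prob X β
  prob_eq_zero : ∀ X, ∀ β ∉ rules X, prob X β = 0
  sum_prob : ∀ X, ∑ β ∈ rules X, prob X β = 1

namespace PBPP

section

variable {Γ : Type u} (S : PBPP Γ)

/-- The distribution of the right-hand side when a process of type `X` is scheduled. -/
def rhs (X : Γ) : PMF (Config Γ) :=
  PMF.ofFinset (fun β => ENNReal.ofReal (S.prob X β)) (S.rules X)
    (by
      rw [← ENNReal.ofReal_sum_of_nonneg fun β hβ => by exact_mod_cast (S.prob_pos X β hβ).le]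
      have h : (∑ β ∈ S.rules X, (S.prob X β : ℝ)) = 1 := by exact_mod_cast S.sum_prob X
      rw [h, ENNReal.ofReal_one])
    (fun β hβ => by simp [S.prob_eq_zero X β hβ])

variable [Fintype Γ]

theorem waiting_nonempty {α : Config Γ} (h : α ≠ 0) :
    (Finset.univ.filter fun X => 1 ≤ α X).Nonempty := by
  obtain ⟨X, hX⟩ := Function.ne_iff.1 h
  exact ⟨X, by simpa [Nat.one_le_iff_ne_zero] using hX⟩

variable [DecidableEq Γ]

/-- The distribution of the next configuration `α - X + β` when a process of type `X` is scheduled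
in `α`, where `α X ≥ 1` (for other `X` the value plays no role). -/
def fire (α : Config Γ) (X : Γ) : PMF (Config Γ) :=
  (S.rhs X).map fun β => α - Pi.single X 1 + β

/-- The uniform distribution on the types that have a waiting process. -/
def pickType (α : Config Γ) (h : α ≠ 0) : PMF Γ :=
  PMF.uniformOfFinset (Finset.univ.filter fun X => 1 ≤ α X) (waiting_nonempty h)

/-- The type of a uniformly chosen waiting process. -/
def pickProc (α : Config Γ) (h : α ≠ 0) : PMF Γ :=
  PMF.ofFintype (fun X => (α X : ℝ≥0∞) / ∑ Y, (α Y : ℝ≥0∞)) (by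
    simp only [div_eq_mul_inv]
    rw [← Finset.sum_mul]
    refine ENNReal.mul_inv_cancel ?_ (ENNReal.sum_ne_top.2 fun _ _ => ENNReal.natCast_ne_top _)
    obtain ⟨X, hX⟩ := Function.ne_iff.1 h
    intro h0
    exact hX (by simpa using (Finset.sum_eq_zero_iff.1 h0) X (Finset.mem_univ X)))

open Classical in
/-- The transition function of the Markov chain in which the type to be scheduled is picked
uniformly among the types with a waiting process. -/
def stepType (α : Config Γ) : PMF (Config Γ) :=
  if h : α = 0 then PMF.pure 0 else (pickType α h).bind (S.fire α)

open Classical in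
/-- The transition function of the Markov chain in which the process to be scheduled is picked
uniformly among the waiting processes. -/
def stepProc (α : Config Γ) : PMF (Config Γ) :=
  if h : α = 0 then PMF.pure 0 else (pickProc α h).bind (S.fire α)

/-- The probability of hitting `F` from `α₀` in the "type" Markov chain. -/
def probType (α₀ : Config Γ) (F : Set (Config Γ)) : ℝ≥0∞ := markovProb S.stepType α₀ F

/-- The probability of hitting `F` from `α₀` in the "process" Markov chain. -/
def probProc (α₀ : Config Γ) (F : Set (Config Γ)) : ℝ≥0∞ := markovProb S.stepProc α₀ F

end

/-- Actions of the MDP of a pBPP: `some X` schedules a process of type `X`, and `none` is the idle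
action, which is enabled only in the empty configuration. -/
def Action (Γ : Type u) : Type u := Option Γ

instance {Γ : Type u} [Finite Γ] : Finite (Action Γ) := inferInstanceAs (Finite (Option Γ))

instance {Γ : Type u} : MeasurableSpace (Action Γ) := ⊤

instance {Γ : Type u} : DiscreteMeasurableSpace (Action Γ) := ⟨fun _ => trivial⟩

/-- Schedule a process of type `X`. -/
def sched {Γ : Type u} (X : Γ) : Action Γ := some X

/-- The idle action. -/
def idle {Γ : Type u} : Action Γ := none

section

variable {Γ : Type u} [Fintype Γ] [DecidableEq Γ]

/-- The Markov decision process induced by a pBPP. -/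
def mdp (S : PBPP Γ) : MDP (Config Γ) (Action Γ) where
  En α := {a | (∃ X, a = sched X ∧ 1 ≤ α X) ∨ (a = idle ∧ α = 0)}
  En_nonempty α := by
    by_cases h : α = 0
    · exact ⟨idle, Or.inr ⟨rfl, h⟩⟩
    · obtain ⟨X, hX⟩ := waiting_nonempty h
      exact ⟨sched X, Or.inl ⟨X, rfl, (Finset.mem_filter.1 hX).2⟩⟩
  δ α a := Option.elim (a : Option Γ) (PMF.pure α) (S.fire α)

/-- A run `α₀ a₁ α₁ a₂ …`, given as the sequence `(α₀, a₁), (α₁, a₂), …`, is `k`-fair if every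
type `X` with a waiting process in `αᵢ` is among the scheduled types `aᵢ₊₁, …, aᵢ₊ₖ`. -/
def FairRun (k : ℕ) (run : ℕ → Config Γ × Action Γ) : Prop :=
  ∀ i X, 1 ≤ (run i).1 X → ∃ j, i ≤ j ∧ j < i + k ∧ (run j).2 = sched X

/-- A scheduler is `k`-fair if it produces only `k`-fair runs. -/
def FairScheduler {S : PBPP Γ} (k : ℕ) (σ : S.mdp.Scheduler) : Prop :=
  ∀ run, σ.Produces run → FairRun k run

/-- The `Q`-states set: the union of the sets `X↑` over the types `X ∈ Q`. -/
def qStates (Q : Finset Γ) : Set (Config Γ) :=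
  ⋃ X ∈ Q, Set.Ici (Pi.single X 1)

end

/-! ### The decision problems -/

/-- A predicate on a type of instances is decidable in polynomial time with respect to an encoding
of the instances as words: some (multi-stack) Turing machine decides it in time polynomial in the
length of the encoding. -/
def DecidableInPolyTime {I A : Type} (enc : I → List A) (p : I → Prop) : Prop :=
  ∃ f : I → Bool, (∀ x, f x = true ↔ p x) ∧
    Nonempty (Turing.TM2ComputableInPolyTime enc Computability.encodeBool f)

/-- An instance of the coverability problem with `Q`-states target sets: a pBPP over the types
`0, …, n - 1`, whose rules are listed in some order, a set `Q` of types, and an initial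
configuration. -/
structure Instance where
  n : ℕ
  S : PBPP (Fin n)
  ruleList : List (Fin n × Config (Fin n))
  ruleList_nodup : ruleList.Nodup
  mem_ruleList : ∀ X β, (X, β) ∈ ruleList ↔ β ∈ S.rules X
  Q : Finset (Fin n)
  start : Config (Fin n)

open Computability (Γ')

/-- A natural number, in binary, followed by a separator. -/
def encNat (m : ℕ) : List Γ' := (Computability.encodeNat m).map Γ'.bit ++ [Γ'.comma]

/-- A configuration, as the list of its entries in binary, in brackets. -/
def encConfig {n : ℕ} (α : Config (Fin n)) : List Γ' :=
  [Γ'.bra] ++ (List.finRange n).flatMap (fun X => encNat (α X)) ++ [Γ'.ket]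

/-- A rule `X ⟶ β` with probability `p`. The type `X` is written as the configuration that
consists of one process of type `X`, and `p` as its numerator and denominator in binary. -/
def encRule {n : ℕ} (X : Fin n) (β : Config (Fin n)) (p : ℚ) : List Γ' :=
  encConfig (Pi.single X 1) ++ encConfig β ++ encNat p.num.toNat ++ encNat p.den

/-- A set of types, as the word of its membership bits, in brackets. -/
def encSet {n : ℕ} (Q : Finset (Fin n)) : List Γ' :=
  [Γ'.bra] ++ (List.finRange n).map (fun X => Γ'.bit (decide (X ∈ Q))) ++ [Γ'.ket]

/-- An instance: the set of target types, the initial configuration, and all rules with their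
probabilities. -/
def encInstance (I : Instance) : List Γ' :=
  encSet I.Q ++ encConfig I.start ++
    I.ruleList.flatMap fun r => encRule r.1 r.2 (I.S.prob r.1 r.2)

/-- An instance of the `k`-fair universal problem: an instance as above together with a number `k`
that is at least the number of types. -/
structure FairInstance extends Instance where
  k : ℕ
  le_k : n ≤ k

/-- A fair instance: the bound `k` in binary, and the rest. -/
def encFairInstance (I : FairInstance) : List Γ' := encNat I.k ++ encInstance I.toInstance

end PBPP

end

/-! Call a type almost sure if it lies in the greatest set V of types such that every member can
spawn a type of Q (`CanReach`), and every rule of a member outside Q spawns a member of V. All four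
conditions say that the initial configuration contains a process of an almost sure type
(`HasAlmostSure`, `tfae_almostSure`).

Sufficiency: until Q is hit, some almost sure process is always waiting (`HasAlmostSure.fire`). From
any waiting process that can reach Q, the probability of hitting Q is at least some ε > 0 that does
not depend on the configuration, provided that no waiting process is neglected forever. Fairness
guarantees this for fair schedulers. In the two chains it holds because configurations grow at most
linearly in time, so that a given waiting type is picked with probability at least 1/(s + cj) at
step j, and the harmonic series diverges. A probability of avoidance that stays below 1 - ε along
all continuations is 0 (`avoidForever_eq_zero`).

Necessity: let c₀ be 1 on the types that cannot reach Q and 0 elsewhere, and let cₙ₊₁(X) be the mean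
of ∏ cₙ over the offspring of X, or 0 if X ∈ Q. These weights increase, and for large n they are
positive exactly on the types that are not almost sure. The product of the weights of the waiting
processes is a submartingale under every scheduler, hence a lower bound for the probability of
avoiding Q (`le_avoid`, `configWeight_le_tsum_fire`).

Only the supports of the rules matter for V, so it is computed by two fixed-point phases of at most
n rounds each: a growing one for `CanReach` and a shrinking one for V. An explicit stack machine
performs them in cubic time (`runs_main`, `finalMarks_iff`). -/

noncomputable section

namespace PBPP

/-! ### Avoidance probabilities -/

section

variable {X : Type u}

open Classical in
/-- The probability that `x` and the next `n` elements of the sequence avoid `F`, after the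
prefix `h`. -/
def avoid (next : List X → X → PMF X) (F : Set X) : ℕ → List X → X → ℝ≥0∞
  | 0, _, x => if x ∈ F then 0 else 1
  | n + 1, h, x => if x ∈ F then 0 else ∑' y, next h x y * avoid next F n (h ++ [x]) y

variable {next : List X → X → PMF X} {F : Set X}

theorem avoid_of_mem {x : X} (hx : x ∈ F) (n : ℕ) (h : List X) : avoid next F n h x = 0 := by
  cases n <;> simp [avoid, hx]

theorem avoid_succ {x : X} (hx : x ∉ F) (n : ℕ) (h : List X) :
    avoid next F (n + 1) h x = ∑' y, next h x y * avoid next F n (h ++ [x]) y := by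
  simp [avoid, hx]

theorem tsum_pmf_mul_le {p : PMF X} {f : X → ℝ≥0∞} {c : ℝ≥0∞} (h : ∀ x, p x ≠ 0 → f x ≤ c) :
    ∑' x, p x * f x ≤ c :=
  calc ∑' x, p x * f x ≤ ∑' x, p x * c := by
        refine ENNReal.tsum_le_tsum fun x => ?_
        by_cases hx : p x = 0
        · simp [hx]
        · gcongr; exact h x hx
    _ = c := by rw [ENNReal.tsum_mul_right, p.tsum_coe, one_mul]

theorem avoid_le_one (n : ℕ) (h : List X) (x : X) : avoid next F n h x ≤ 1 := by
  induction n generalizing h x with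
  | zero => unfold avoid; split_ifs <;> simp
  | succ n ih =>
    unfold avoid; split_ifs
    · simp
    · exact tsum_pmf_mul_le fun y _ => ih _ _

theorem avoid_succ_le (n : ℕ) (h : List X) (x : X) :
    avoid next F (n + 1) h x ≤ avoid next F n h x := by
  induction n generalizing h x with
  | zero =>
    by_cases hx : x ∈ F
    · simp [avoid_of_mem hx]
    · simpa [avoid, hx] using avoid_le_one (next := next) (F := F) 1 h x
  | succ n ih =>
    by_cases hx : x ∈ F
    · simp [avoid_of_mem hx]
    · rw [avoid_succ hx, avoid_succ hx]
      gcongr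
      exact ih _ _

theorem avoid_antitone (h : List X) (x : X) : Antitone fun n => avoid next F n h x :=
  antitone_nat_of_succ_le fun n => avoid_succ_le n h x

/-- A bounded submartingale that vanishes on `F` is a lower bound for avoidance probabilities. -/
theorem le_avoid {g : List X → X → ℝ≥0∞} (g_le : ∀ h x, g h x ≤ 1)
    (g_mem : ∀ h, ∀ x ∈ F, g h x = 0)
    (g_sub : ∀ h, ∀ x ∉ F, g h x ≤ ∑' y, next h x y * g (h ++ [x]) y)
    (n : ℕ) (h : List X) (x : X) : g h x ≤ avoid next F n h x := by
  induction n generalizing h x with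
  | zero =>
    by_cases hx : x ∈ F
    · simp [g_mem h x hx]
    · simpa [avoid, hx] using g_le h x
  | succ n ih =>
    by_cases hx : x ∈ F
    · simp [g_mem h x hx]
    · rw [avoid_succ hx]
      refine (g_sub h x hx).trans ?_
      gcongr
      exact ih _ _

/-- The probability that `x` and all later elements of the sequence avoid `F`, after the
prefix `h`. -/
def avoidForever (next : List X → X → PMF X) (F : Set X) (h : List X) (x : X) : ℝ≥0∞ :=
  ⨅ n, avoid next F n h x

theorem avoidForever_le_one (h : List X) (x : X) : avoidForever next F h x ≤ 1 :=
  (iInf_le _ 0).trans (avoid_le_one 0 h x)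

theorem avoidForever_of_mem {x : X} (hx : x ∈ F) (h : List X) : avoidForever next F h x = 0 :=
  le_antisymm ((iInf_le _ 0).trans (avoid_of_mem hx 0 h).le) zero_le

/-- Monotone convergence for decreasing functions, with `p` as a density of the counting measure;
the bound by 1 makes the first integral finite. -/
theorem tsum_pmf_mul_iInf {p : PMF X} {f : ℕ → X → ℝ≥0∞} (hf : ∀ x, Antitone fun n => f n x)
    (h1 : ∀ n x, f n x ≤ 1) :
    ∑' x, p x * ⨅ n, f n x = ⨅ n, ∑' x, p x * f n x := by
  let : MeasurableSpace X := ⊤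
  have : DiscreteMeasurableSpace X := ⟨fun _ => trivial⟩
  have key : ∀ g : X → ℝ≥0∞, (∀ x, g x ≤ 1) →
      ∫⁻ x, g x ∂((Measure.count : Measure X).withDensity p) = ∑' x, p x * g x := by
    intro g _
    rw [lintegral_withDensity_eq_lintegral_mul _ Measurable.of_discrete
      Measurable.of_discrete, lintegral_count]
    rfl
  rw [← key _ fun x => (iInf_le _ 0).trans (h1 0 x), lintegral_iInf]
  · simp_rw [key _ (h1 _)]
  · exact fun n => Measurable.of_discrete
  · exact fun m n hmn x => hf x hmn
  · rw [key _ (h1 0)]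
    exact ((tsum_pmf_mul_le fun x _ => h1 0 x).trans_lt ENNReal.one_lt_top).ne

theorem avoidForever_eq {x : X} (hx : x ∉ F) (h : List X) :
    avoidForever next F h x = ∑' y, next h x y * avoidForever next F (h ++ [x]) y := by
  unfold avoidForever
  rw [tsum_pmf_mul_iInf (fun _ => avoid_antitone _ _) (fun _ _ => avoid_le_one _ _ _)]
  simp_rw [← avoid_succ hx]
  exact ((avoid_antitone h x).iInf_nat_add 1).symm

/-- If the probability of avoiding `F` forever is bounded away from `1` on an invariant set of
prefixes, then it vanishes there. -/
theorem avoidForever_eq_zero {good : List X → X → Prop} {q : ℝ≥0∞} (hq : q < 1)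
    (inv : ∀ h x, good h x → x ∉ F → ∀ y, next h x y ≠ 0 → good (h ++ [x]) y)
    (bound : ∀ h x, good h x → avoidForever next F h x ≤ q) (h : List X) (x : X)
    (hg : good h x) : avoidForever next F h x = 0 := by
  -- To avoid `F` forever one must survive `n` steps and then avoid `F` from a good prefix, which
  -- has probability at most `q`. Letting `n` grow gives v ≤ q * v for a finite v, so v = 0.
  have key : ∀ n h x, good h x → avoidForever next F h x ≤ q * avoid next F n h x := by
    intro n
    induction n with
    | zero =>
      intro h x hg
      by_cases hx : x ∈ F
      · simp [avoidForever_of_mem hx]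
      · simpa [avoid, hx] using bound h x hg
    | succ n ih =>
      intro h x hg
      by_cases hx : x ∈ F
      · simp [avoidForever_of_mem hx]
      · rw [avoidForever_eq hx, avoid_succ hx, ← ENNReal.tsum_mul_left]
        refine ENNReal.tsum_le_tsum fun y => ?_
        by_cases hy : next h x y = 0
        · simp [hy]
        · rw [mul_left_comm]
          gcongr
          exact ih _ _ (inv h x hg hx y hy)
  have h2 : avoidForever next F h x ≤ q * avoidForever next F h x := by
    conv_rhs => rw [avoidForever, ENNReal.mul_iInf (by simp [hq.ne_top])]
    exact le_iInf fun n => key n h x hg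
  by_contra h0
  have := ENNReal.mul_lt_mul_left h0 (avoidForever_le_one h x |>.trans_lt ENNReal.one_lt_top).ne hq
  rw [one_mul] at this
  exact absurd h2 (not_le.2 this)

end

end PBPP
end

/-! ### Avoidance functions as probabilities under `seqLaw` -/

noncomputable section

namespace PBPP

theorem measurableSet_hit {X : Type u} [MeasurableSpace X] [DiscreteMeasurableSpace X] (F : Set X) :
    MeasurableSet {run : ℕ → X | ∃ i, run i ∈ F} := by
  simp only [Set.ofPred_exists]
  exact MeasurableSet.iUnion fun i => measurable_pi_apply i (MeasurableSet.of_discrete (s := F))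

section

variable {X : Type u} [Countable X] [MeasurableSpace X] [DiscreteMeasurableSpace X]

instance (init : PMF X) (next : List X → X → PMF X) : IsProbabilityMeasure (seqLaw init next) := by
  have := PMF.toMeasure.isProbabilityMeasure init
  unfold seqLaw
  infer_instance

theorem lintegral_toMeasure (p : PMF X) (f : X → ℝ≥0∞) :
    ∫⁻ x, f x ∂p.toMeasure = ∑' x, p x * f x := by
  rw [lintegral_countable']
  simp_rw [PMF.toMeasure_apply_singleton p _ (MeasurableSet.singleton _), mul_comm]

variable (init : PMF X) (next : List X → X → PMF X) (F : Set X)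

/-- The Markov property: the joint law of the first coordinates and the next one is the marginal
composed with the kernel. -/
theorem lintegral_seqLaw_succ (m : ℕ) (f : List X → X → X → ℝ≥0∞) :
    ∫⁻ run, f (List.ofFn fun i : Fin m => run i) (run m) (run (m + 1)) ∂seqLaw init next =
      ∫⁻ run, ∑' y, next (List.ofFn fun i : Fin m => run i) (run m) y *
        f (List.ofFn fun i : Fin m => run i) (run m) y ∂seqLaw init next := by
  have := PMF.toMeasure.isProbabilityMeasure init
  let κ := seqKernel next
  have key := Kernel.map_frestrictLe_trajMeasure_compProd_eq_map_trajMeasure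
    (X := fun _ : ℕ => X) (μ₀ := init.toMeasure) (κ := κ) (a := m)
  let l (z : (i : Finset.Iic m) → X) : List X :=
    List.ofFn fun i : Fin m => z ⟨i, Finset.mem_Iic.2 i.2.le⟩
  let φ : ((i : Finset.Iic m) → X) × X → ℝ≥0∞ := fun p =>
    f (l p.1) (p.1 ⟨m, Finset.mem_Iic.2 le_rfl⟩) p.2
  have e := congrArg (fun μ => ∫⁻ p, φ p ∂μ) key
  have hφ : Measurable φ := Measurable.of_discrete
  rw [lintegral_map hφ (by fun_prop), Measure.lintegral_compProd hφ,
    lintegral_map Measurable.of_discrete (by fun_prop)] at e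
  refine Eq.trans e.symm (lintegral_congr fun run => ?_)
  exact lintegral_toMeasure _ _

theorem lintegral_seqLaw_zero (f : X → ℝ≥0∞) :
    ∫⁻ run, f (run 0) ∂seqLaw init next = ∑' x, init x * f x := by
  have := PMF.toMeasure.isProbabilityMeasure init
  have h : (seqLaw init next).map (fun run => run 0) = init.toMeasure := by
    have e : (fun run : ℕ → X => run 0) =
        (fun z : (i : Finset.Iic 0) → X => z ⟨0, Finset.mem_Iic.2 le_rfl⟩) ∘
          Preorder.frestrictLe (π := fun _ : ℕ => X) 0 := rfl
    rw [e, ← Measure.map_map (by fun_prop) (by fun_prop), seqLaw, Kernel.trajMeasure,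
      Measure.map_comp _ _ (by fun_prop), Kernel.traj_map_frestrictLe, Kernel.partialTraj_self,
      Measure.id_comp, Measure.map_map (by fun_prop) (by fun_prop)]
    exact Measure.map_id (μ := init.toMeasure)
  rw [← lintegral_map (μ := seqLaw init next) Measurable.of_discrete (measurable_pi_apply 0), h,
    lintegral_toMeasure]

-- The remaining avoidance probability, restricted to runs that have survived so far, has a mean
-- that depends only on `m + n`. With `n = 0` the left side is the probability that entries `0, …,
-- m` avoid `F`.
open Classical in
theorem lintegral_avoid (m n : ℕ) :
    ∫⁻ run, (if ∀ i < m, run i ∉ F then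
      avoid next F n (List.ofFn fun i : Fin m => run i) (run m) else 0) ∂seqLaw init next =
    ∑' x, init x * avoid next F (m + n) [] x := by
  induction m generalizing n with
  | zero =>
    rw [← lintegral_seqLaw_zero init next]
    simp
  | succ m ih =>
    rw [Nat.add_right_comm, add_assoc, ← ih]
    -- Survival is phrased through membership in the list `h ++ [x]`, so that the integrand is a
    -- function of prefix, current entry and next entry.
    have e := lintegral_seqLaw_succ init next m fun h x y =>
      if ∀ z ∈ h ++ [x], z ∉ F then avoid next F n (h ++ [x]) y else 0
    have h1 : ∀ run : ℕ → X, (∀ z ∈ (List.ofFn fun i : Fin m => run i) ++ [run m], z ∉ F) ↔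
        ∀ i < m + 1, run i ∉ F := by
      intro run
      simp only [List.mem_append, List.mem_ofFn, List.mem_singleton, Nat.lt_succ_iff_lt_or_eq]
      constructor
      · rintro h i (hi | rfl)
        · exact h _ (Or.inl ⟨⟨i, hi⟩, rfl⟩)
        · exact h _ (Or.inr rfl)
      · rintro h z (⟨i, rfl⟩ | rfl)
        · exact h _ (Or.inl i.2)
        · exact h _ (Or.inr rfl)
    simp only [h1] at e
    have h2 : ∀ run : ℕ → X, (List.ofFn fun i : Fin (m + 1) => run i) =
        (List.ofFn fun i : Fin m => run i) ++ [run m] := by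
      intro run
      rw [List.ofFn_succ', List.concat_eq_append]
      rfl
    simp only [h2]
    rw [e]
    refine lintegral_congr fun run => ?_
    by_cases hm : run m ∈ F
    · have : ¬ ∀ i < m + 1, run i ∉ F := fun h => h m (by omega) hm
      simp only [this, if_false, avoid_of_mem hm, mul_zero, tsum_zero, ite_self]
    · have : (∀ i < m + 1, run i ∉ F) ↔ ∀ i < m, run i ∉ F :=
        ⟨fun h i hi => h i (by omega), fun h i hi => by
          rcases Nat.lt_succ_iff_lt_or_eq.1 hi with hi | rfl
          · exact h i hi
          · exact hm⟩
      simp only [this, avoid_succ hm]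
      split_ifs <;> simp

theorem seqLaw_compl_hit :
    seqLaw init next {run | ∃ i, run i ∈ F}ᶜ = ∑' x, init x * avoidForever next F [] x := by
  classical
  unfold avoidForever
  rw [tsum_pmf_mul_iInf (fun _ => avoid_antitone _ _) (fun _ _ => avoid_le_one _ _ _)]
  have e : {run : ℕ → X | ∃ i, run i ∈ F}ᶜ = ⋂ n, {run : ℕ → X | ∀ i < n, run i ∉ F} := by
    ext run
    simp only [Set.mem_compl_iff, Set.mem_ofPred_eq, not_exists, Set.mem_iInter]
    exact ⟨fun h _ i _ => h i, fun h i => h (i + 1) i (by omega)⟩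
  have meas : ∀ n, MeasurableSet {run : ℕ → X | ∀ i < n, run i ∉ F} := fun n => by
    simp only [Set.ofPred_forall]
    exact MeasurableSet.iInter fun i => MeasurableSet.iInter fun _ =>
      (measurable_pi_apply i : Measurable fun run : ℕ → X => run i)
        (MeasurableSet.of_discrete (s := Fᶜ))
  rw [e, Antitone.measure_iInter]
  · have anti : Antitone fun n => seqLaw init next {run : ℕ → X | ∀ i < n, run i ∉ F} :=
      fun m n hmn => measure_mono fun run h i hi => h i (hi.trans_le hmn)
    -- Horizon `n` inspects the `n + 1` entries `0, …, n`, hence the shift.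
    rw [← anti.iInf_nat_add 1]
    refine iInf_congr fun n => ?_
    have h0 := lintegral_avoid init next F n 0
    rw [add_zero] at h0
    rw [← h0, ← lintegral_indicator_one (meas _)]
    refine lintegral_congr fun run => ?_
    by_cases hm : run n ∈ F
    · have : ¬ ∀ i < n + 1, run i ∉ F := fun h => h n (by omega) hm
      rw [Set.indicator_apply]
      simp only [Set.mem_ofPred_eq, this, if_false, avoid_of_mem hm, ite_self]
    · have : (∀ i < n + 1, run i ∉ F) ↔ ∀ i < n, run i ∉ F :=
        ⟨fun h i hi => h i (by omega), fun h i hi => by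
          rcases Nat.lt_succ_iff_lt_or_eq.1 hi with hi | rfl
          · exact h i hi
          · exact hm⟩
      rw [Set.indicator_apply]
      simp only [Set.mem_ofPred_eq, this, avoid, hm, if_false, Pi.one_apply]
  · exact fun m n hmn run h i hi => h i (hi.trans_le hmn)
  · exact fun n => (meas n).nullMeasurableSet
  · exact ⟨0, measure_ne_top _ _⟩

theorem seqLaw_hit_eq_one_iff :
    seqLaw init next {run | ∃ i, run i ∈ F} = 1 ↔
      ∑' x, init x * avoidForever next F [] x = 0 := by
  rw [← seqLaw_compl_hit, prob_compl_eq_zero_iff (measurableSet_hit F)]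

end

end PBPP
end

noncomputable section

namespace PBPP

theorem tsum_pmf_bind_mul {A B : Type*} (p : PMF A) (f : A → PMF B) (g : B → ℝ≥0∞) :
    ∑' b, p.bind f b * g b = ∑' a, p a * ∑' b, f a b * g b := by
  simp_rw [PMF.bind_apply, ← ENNReal.tsum_mul_right, ← ENNReal.tsum_mul_left, mul_assoc]
  exact ENNReal.tsum_comm

theorem tsum_pmf_pure_mul {A : Type*} (a : A) (g : A → ℝ≥0∞) :
    ∑' b, PMF.pure a b * g b = g a := by
  classical
  rw [tsum_eq_single a fun b hb => by simp [PMF.pure_apply, hb]]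
  simp

theorem tsum_pmf_map_mul {A B : Type*} (p : PMF A) (f : A → B) (g : B → ℝ≥0∞) :
    ∑' b, p.map f b * g b = ∑' a, p a * g (f a) := by
  rw [← PMF.bind_pure_comp, tsum_pmf_bind_mul]
  simp

/-! ### Types from which the target is hit almost surely -/

section

variable {Γ : Type u} (S : PBPP Γ)

theorem rhs_ne_zero_iff {X : Γ} {β : Config Γ} : S.rhs X β ≠ 0 ↔ β ∈ S.rules X := by
  unfold rhs
  rw [PMF.ofFinset_apply]
  constructor
  · intro h
    by_contra hβ
    exact h (by simp [S.prob_eq_zero X β hβ])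
  · intro h
    have : (0 : ℝ) < S.prob X β := by exact_mod_cast S.prob_pos X β h
    simpa using this

/-- A process of type `X` can spawn a process with a type in `Q`. -/
inductive CanReach (Q : Finset Γ) : Γ → Prop
  | target {X : Γ} : X ∈ Q → CanReach Q X
  | step {X Y : Γ} {β : Config Γ} : β ∈ S.rules X → 1 ≤ β Y → CanReach Q Y → CanReach Q X

variable [Fintype Γ]

/-- The weight of a configuration is the product of the weights of its processes. -/
def configWeight (c : Γ → ℝ≥0∞) (α : Config Γ) : ℝ≥0∞ := ∏ Y, c Y ^ α Y

theorem configWeight_add (c : Γ → ℝ≥0∞) (α β : Config Γ) :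
    configWeight c (α + β) = configWeight c α * configWeight c β := by
  simp [configWeight, pow_add, Finset.prod_mul_distrib]

theorem configWeight_mono {c d : Γ → ℝ≥0∞} (h : c ≤ d) (α : Config Γ) :
    configWeight c α ≤ configWeight d α :=
  Finset.prod_le_prod' fun Y _ => pow_le_pow_left' (h Y) _

theorem configWeight_le_one {c : Γ → ℝ≥0∞} (h : c ≤ 1) (α : Config Γ) : configWeight c α ≤ 1 :=
  (configWeight_mono h α).trans (by simp [configWeight])

theorem configWeight_eq_zero_iff {c : Γ → ℝ≥0∞} {α : Config Γ} :
    configWeight c α = 0 ↔ ∃ Y, 1 ≤ α Y ∧ c Y = 0 := by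
  simp only [configWeight, Finset.prod_eq_zero_iff, Finset.mem_univ, true_and, pow_eq_zero_iff',
    Nat.one_le_iff_ne_zero, and_comm, ne_eq]

theorem configWeight_eq_one {c : Γ → ℝ≥0∞} {α : Config Γ} (h : ∀ Y, 1 ≤ α Y → c Y = 1) :
    configWeight c α = 1 := by
  refine Finset.prod_eq_one fun Y _ => ?_
  by_cases hY : α Y = 0
  · simp [hY]
  · rw [h Y (by omega), one_pow]

variable [DecidableEq Γ]

omit [Fintype Γ] in
theorem sub_single_add_single {α : Config Γ} {X : Γ} (hX : 1 ≤ α X) :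
    α - Pi.single X 1 + Pi.single X 1 = α := by
  ext Y
  by_cases h : Y = X
  · subst h; simp; omega
  · simp [h]

theorem configWeight_sub_single (c : Γ → ℝ≥0∞) {α : Config Γ} {X : Γ} (hX : 1 ≤ α X) :
    configWeight c α = configWeight c (α - Pi.single X 1) * c X := by
  conv_lhs => rw [← sub_single_add_single hX, configWeight_add]
  congr 1
  rw [configWeight, Finset.prod_eq_single X]
  · simp
  · intro Y _ hY; simp [hY]
  · simp

variable (Q : Finset Γ)

open Classical in
/-- Lower bounds for the probability that the offspring of a process of type `X` avoids `Q`. -/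
def typeWeight : ℕ → Γ → ℝ≥0∞
  | 0, X => if CanReach S Q X then 0 else 1
  | n + 1, X => if X ∈ Q then 0 else ∑' β, S.rhs X β * configWeight (typeWeight n) β

theorem typeWeight_of_mem {X : Γ} (hX : X ∈ Q) (n : ℕ) : typeWeight S Q n X = 0 := by
  cases n
  · simp [typeWeight, CanReach.target hX]
  · simp [typeWeight, hX]

theorem typeWeight_succ {X : Γ} (hX : X ∉ Q) (n : ℕ) :
    typeWeight S Q (n + 1) X = ∑' β, S.rhs X β * configWeight (typeWeight S Q n) β := by
  simp [typeWeight, hX]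

theorem typeWeight_le_one (n : ℕ) : typeWeight S Q n ≤ 1 := by
  induction n with
  | zero => intro X; unfold typeWeight; split_ifs <;> simp
  | succ n ih =>
    intro X; unfold typeWeight; split_ifs
    · simp
    · exact tsum_pmf_mul_le fun β _ => configWeight_le_one ih β

/-- A type that cannot reach `Q` spawns only such types, so its weight 1 reproduces itself;
afterwards monotonicity propagates through the recursion. -/
theorem typeWeight_le_succ (n : ℕ) : typeWeight S Q n ≤ typeWeight S Q (n + 1) := by
  induction n with
  | zero =>
    intro X
    by_cases hX : CanReach S Q X
    · simp [typeWeight, hX]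
    · have hQ : X ∉ Q := fun h => hX (CanReach.target h)
      have : ∀ β, S.rhs X β * configWeight (typeWeight S Q 0) β = S.rhs X β := by
        intro β
        by_cases hβ : S.rhs X β = 0
        · simp [hβ]
        · rw [configWeight_eq_one, mul_one]
          intro Y hY
          have : ¬ CanReach S Q Y := fun h => hX (CanReach.step (S.rhs_ne_zero_iff.1 hβ) hY h)
          simp [typeWeight, this]
      rw [typeWeight_succ S Q hQ]
      simp_rw [this, PMF.tsum_coe]
      exact typeWeight_le_one S Q 0 X
  | succ n ih =>
    intro X
    by_cases hX : X ∈ Q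
    · simp [typeWeight_of_mem S Q hX]
    · rw [typeWeight_succ S Q hX, typeWeight_succ S Q hX]
      gcongr
      exact configWeight_mono ih _

theorem typeWeight_mono : Monotone (typeWeight S Q) :=
  monotone_nat_of_le_succ (typeWeight_le_succ S Q)

theorem tsum_fire_mul_configWeight (c : Γ → ℝ≥0∞) (α : Config Γ) (X : Γ) :
    ∑' α', S.fire α X α' * configWeight c α' =
      configWeight c (α - Pi.single X 1) * ∑' β, S.rhs X β * configWeight c β := by
  unfold fire
  rw [tsum_pmf_map_mul, ← ENNReal.tsum_mul_left]
  simp_rw [configWeight_add, mul_left_comm]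

/-- Firing `X` replaces the factor of one process of type `X` by the mean weight of its offspring,
which is the next iterate at `X` and hence no smaller. The choice of `X` is arbitrary, so the weight
is a submartingale under every scheduling. -/
theorem configWeight_le_tsum_fire (n : ℕ) {α : Config Γ} {X : Γ} (hα : 1 ≤ α X) (hX : X ∉ Q) :
    configWeight (typeWeight S Q n) α ≤
      ∑' α', S.fire α X α' * configWeight (typeWeight S Q n) α' := by
  rw [tsum_fire_mul_configWeight, configWeight_sub_single _ hα, ← typeWeight_succ S Q hX]
  gcongr
  exact typeWeight_le_succ S Q n X

/-- The types whose offspring contains a type in `Q` almost surely. -/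
def AlmostSure (X : Γ) : Prop := ∀ n, typeWeight S Q n X = 0

/-- The weights increase and there are finitely many types, so a single index serves all of them. -/
theorem exists_typeWeight_ne_zero : ∃ n, ∀ X, ¬ AlmostSure S Q X → typeWeight S Q n X ≠ 0 := by
  have : ∀ X, ∃ n, ¬ AlmostSure S Q X → typeWeight S Q n X ≠ 0 := fun X => by
    by_cases h : AlmostSure S Q X
    · exact ⟨0, fun h' => absurd h h'⟩
    · obtain ⟨n, hn⟩ := not_forall.1 h
      exact ⟨n, fun _ => hn⟩
  choose f hf using this
  refine ⟨Finset.univ.sup f, fun X hX h0 => hf X hX ?_⟩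
  have := typeWeight_mono S Q (Finset.le_sup (f := f) (Finset.mem_univ X)) X
  exact le_antisymm (this.trans h0.le) zero_le

variable {S Q}

theorem AlmostSure.canReach {X : Γ} (h : AlmostSure S Q X) : CanReach S Q X := by
  by_contra h'
  simpa [typeWeight, h'] using h 0

/-- If the mean at level `n + 1` vanishes, so does the product for each rule, hence one of its
factors at level `n`. For the uniform index `n` a vanishing factor belongs to an almost sure type.
-/
theorem AlmostSure.exists_child {X : Γ} (h : AlmostSure S Q X) (hX : X ∉ Q) {β : Config Γ}
    (hβ : β ∈ S.rules X) : ∃ Y, 1 ≤ β Y ∧ AlmostSure S Q Y := by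
  obtain ⟨n, hn⟩ := exists_typeWeight_ne_zero S Q
  have h0 := h (n + 1)
  rw [typeWeight_succ S Q hX, ENNReal.tsum_eq_zero] at h0
  have h1 := (mul_eq_zero.1 (h0 β)).resolve_left (S.rhs_ne_zero_iff.2 hβ)
  obtain ⟨Y, hY, hY0⟩ := configWeight_eq_zero_iff.1 h1
  exact ⟨Y, hY, by_contra fun h => hn Y h hY0⟩

/-- The set of almost sure types is the greatest set with these closure properties. -/
theorem almostSure_of_closed {V : Γ → Prop} (reach : ∀ X, V X → CanReach S Q X)
    (child : ∀ X, V X → X ∉ Q → ∀ β ∈ S.rules X, ∃ Y, 1 ≤ β Y ∧ V Y) {X : Γ} (hX : V X) :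
    AlmostSure S Q X := by
  intro n
  induction n generalizing X with
  | zero => simp [typeWeight, reach X hX]
  | succ n ih =>
    by_cases hQ : X ∈ Q
    · exact typeWeight_of_mem S Q hQ _
    · rw [typeWeight_succ S Q hQ, ENNReal.tsum_eq_zero]
      intro β
      by_cases hβ : S.rhs X β = 0
      · simp [hβ]
      · obtain ⟨Y, hY, hV⟩ := child X hX hQ β (S.rhs_ne_zero_iff.1 hβ)
        rw [configWeight_eq_zero_iff.2 ⟨Y, hY, ih hV⟩, mul_zero]

/-- Some process of `α` has an almost sure type. -/
def HasAlmostSure (S : PBPP Γ) (Q : Finset Γ) (α : Config Γ) : Prop :=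
  ∃ X, 1 ≤ α X ∧ AlmostSure S Q X

theorem exists_configWeight_ne_zero {α : Config Γ} (h : ¬ HasAlmostSure S Q α) :
    ∃ n, configWeight (typeWeight S Q n) α ≠ 0 := by
  obtain ⟨n, hn⟩ := exists_typeWeight_ne_zero S Q
  refine ⟨n, fun h0 => h ?_⟩
  obtain ⟨Y, hY, h0⟩ := configWeight_eq_zero_iff.1 h0
  exact ⟨Y, hY, by_contra fun h => hn Y h h0⟩

omit [Fintype Γ] in
theorem mem_qStates {α : Config Γ} : α ∈ qStates Q ↔ ∃ X ∈ Q, 1 ≤ α X := by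
  simp only [qStates, Set.mem_iUnion, Set.mem_Ici, exists_prop]
  refine exists_congr fun X => and_congr_right fun _ => ⟨fun h => ?_, fun h Y => ?_⟩
  · simpa using h X
  · by_cases hY : Y = X
    · subst hY; simpa using h
    · simp [hY]

theorem configWeight_of_mem_qStates {α : Config Γ} (h : α ∈ qStates Q) (n : ℕ) :
    configWeight (typeWeight S Q n) α = 0 := by
  obtain ⟨X, hX, hα⟩ := mem_qStates.1 h
  exact configWeight_eq_zero_iff.2 ⟨X, hα, typeWeight_of_mem S Q hX n⟩

omit [Fintype Γ] in
theorem mem_support_fire {α α' : Config Γ} {X : Γ} (h : S.fire α X α' ≠ 0) :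
    ∃ β ∈ S.rules X, α' = α - Pi.single X 1 + β := by
  unfold fire at h
  rw [← PMF.mem_support_iff, PMF.support_map] at h
  obtain ⟨β, hβ, rfl⟩ := h
  exact ⟨β, S.rhs_ne_zero_iff.1 hβ, rfl⟩

omit [Fintype Γ] in
theorem le_of_fire_ne_zero {α α' : Config Γ} {X Y : Γ} (h : S.fire α X α' ≠ 0) (hY : Y ≠ X) :
    α Y ≤ α' Y := by
  obtain ⟨β, -, rfl⟩ := mem_support_fire h
  simp [hY]

/-- An almost sure process either keeps waiting or, when it is fired outside `Q`, leaves an almost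
sure child. -/
theorem HasAlmostSure.fire {α α' : Config Γ} {X : Γ} (hα : HasAlmostSure S Q α)
    (hF : α ∉ qStates Q) (h : S.fire α X α' ≠ 0) : HasAlmostSure S Q α' := by
  obtain ⟨Y, hY, hs⟩ := hα
  by_cases e : Y = X
  · subst e
    obtain ⟨β, hβ, rfl⟩ := mem_support_fire h
    obtain ⟨Z, hZ, hZs⟩ := hs.exists_child (fun hQ => hF (mem_qStates.2 ⟨_, hQ, hY⟩)) hβ
    exact ⟨Z, by simp; omega, hZs⟩
  · exact ⟨Y, hY.trans (le_of_fire_ne_zero h e), hs⟩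

end

end PBPP
end

noncomputable section

namespace PBPP

/-! ### The two Markov chains -/

theorem tsum_pmf_mul_le_one_sub {A : Type*} (p : PMF A) {f : A → ℝ≥0∞} (hf : ∀ a, f a ≤ 1)
    {a₀ : A} {ε : ℝ≥0∞} (hε : ε ≤ 1) (h₀ : f a₀ ≤ 1 - ε) :
    ∑' a, p a * f a ≤ 1 - p a₀ * ε := by
  classical
  have hp : p a₀ * ε ≤ 1 := mul_le_one' (p.coe_le_one a₀) hε
  refine ENNReal.le_sub_of_add_le_right (hp.trans_lt ENNReal.one_lt_top).ne ?_
  have e : p a₀ * ε = ∑' a, p a * (if a = a₀ then ε else 0) := by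
    rw [tsum_eq_single a₀ fun a ha => by simp [ha]]; simp
  rw [e, ← ENNReal.tsum_add]
  simp_rw [← mul_add]
  refine tsum_pmf_mul_le fun a _ => ?_
  split_ifs with ha
  · subst ha
    exact (add_le_add_left h₀ ε).trans (tsub_add_cancel_of_le hε).le
  · simpa using hf a

/-- Used with `a₀` the type one waits for: picking it gives the bound `b`, any other pick costs an
extra error `R`. -/
theorem tsum_pmf_mul_le_add {A : Type*} (p : PMF A) {f : A → ℝ≥0∞} {a₀ : A} {b R : ℝ≥0∞}
    (hR : R ≠ ∞) (h₀ : f a₀ ≤ b) (hf : ∀ a, p a ≠ 0 → a ≠ a₀ → f a ≤ b + R) :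
    ∑' a, p a * f a ≤ b + (1 - p a₀) * R := by
  classical
  have e : ∑' a, p a * (if a = a₀ then 0 else R) ≤ (1 - p a₀) * R := by
    rw [ENNReal.sub_mul fun _ _ => hR, one_mul]
    refine ENNReal.le_sub_of_add_le_right (ENNReal.mul_ne_top (p.apply_ne_top a₀) hR) ?_
    have e : p a₀ * R = ∑' a, p a * (if a = a₀ then R else 0) := by
      rw [tsum_eq_single a₀ fun a ha => by simp [ha]]; simp
    rw [e, ← ENNReal.tsum_add]
    simp_rw [← mul_add]
    exact tsum_pmf_mul_le fun a _ => by split_ifs <;> simp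
  refine le_trans ?_ (add_le_add_right e b)
  have e2 : b = ∑' a, p a * b := by rw [ENNReal.tsum_mul_right, p.tsum_coe, one_mul]
  conv_rhs => rw [e2, ← ENNReal.tsum_add]
  refine ENNReal.tsum_le_tsum fun a => ?_
  by_cases ha : p a = 0
  · simp [ha]
  rw [← mul_add]
  gcongr
  split_ifs with h
  · subst h; simpa using h₀
  · exact hf a ha h

theorem exists_uniform_pos {A : Type*} [Finite A] {P : A → ℝ≥0∞ → Prop}
    (anti : ∀ a ε ε', ε' ≤ ε → P a ε → P a ε') (h : ∀ a, ∃ ε, ε ≠ 0 ∧ P a ε) :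
    ∃ ε, ε ≠ 0 ∧ ∀ a, P a ε := by
  have := Fintype.ofFinite A
  choose f hf0 hf using h
  refine ⟨Finset.univ.inf f, ?_, fun a => anti a _ _ (Finset.inf_le (Finset.mem_univ a)) (hf a)⟩
  rw [← pos_iff_ne_zero, Finset.lt_inf_iff (by simp)]
  exact fun a _ => pos_iff_ne_zero.2 (hf0 a)

/-- `harmonicDecay c n s` is `exp (-∑ j < n, 1 / (s + c * j))`. -/
def harmonicDecay (c n s : ℕ) : ℝ≥0∞ :=
  ENNReal.ofReal (Real.exp (-∑ j ∈ Finset.range n, 1 / ((s : ℝ) + c * j)))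

/-- One factor of the product of the 1 - 1/(s + cj) is absorbed by 1 - x ≤ exp (-x). -/
theorem one_sub_inv_mul_harmonicDecay_le (c n : ℕ) {s : ℕ} (hs : 1 ≤ s) :
    (1 - (s : ℝ≥0∞)⁻¹) * harmonicDecay c n (s + c) ≤ harmonicDecay c (n + 1) s := by
  have hs' : (0 : ℝ) < s := by exact_mod_cast hs
  have e : (1 - (s : ℝ≥0∞)⁻¹) = ENNReal.ofReal (1 - 1 / (s : ℝ)) := by
    rw [ENNReal.ofReal_sub _ (by positivity), one_div, ENNReal.ofReal_inv_of_pos hs']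
    simp
  rw [e, harmonicDecay, harmonicDecay, Finset.sum_range_succ', neg_add, Real.exp_add, mul_comm,
    ENNReal.ofReal_mul (Real.exp_pos _).le]
  refine mul_le_mul' (le_of_eq ?_) (ENNReal.ofReal_le_ofReal ?_)
  · congr 4 with j
    push_cast
    ring
  · have := Real.add_one_le_exp (-(1 / (s : ℝ)))
    simp only [Nat.cast_zero, mul_zero, add_zero]
    linarith

theorem iInf_harmonicDecay (c : ℕ) {s : ℕ} (hs : 1 ≤ s) : ⨅ n, harmonicDecay c n s = 0 := by
  have hs' : (0 : ℝ) < s := by exact_mod_cast hs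
  have h1 : Filter.Tendsto (fun n => ∑ j ∈ Finset.range n, 1 / ((s : ℝ) + c * j))
      Filter.atTop Filter.atTop := by
    -- The comparison with the harmonic series uses s + cj ≤ (s + c)(j + 1).
    have h0 := Real.tendsto_sum_range_one_div_nat_succ_atTop.const_mul_atTop
      (r := 1 / ((s : ℝ) + c)) (by positivity)
    refine Filter.tendsto_atTop_mono (fun n => ?_) h0
    rw [Finset.mul_sum]
    refine Finset.sum_le_sum fun j _ => ?_
    rw [one_div_mul_one_div]
    refine one_div_le_one_div_of_le (by positivity) ?_
    have : (0 : ℝ) ≤ s * j := by positivity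
    have : (0 : ℝ) ≤ c := by positivity
    nlinarith
  have h2 : Filter.Tendsto (fun n => harmonicDecay c n s) Filter.atTop (nhds 0) := by
    rw [← ENNReal.ofReal_zero]
    exact ENNReal.tendsto_ofReal
      (Real.tendsto_exp_atBot.comp (Filter.tendsto_neg_atTop_atBot.comp h1))
  exact le_antisymm (ge_of_tendsto' h2 fun n => iInf_le _ n) zero_le

section

variable {Γ : Type u} [Fintype Γ] [DecidableEq Γ]

/-- The step of a Markov chain that picks every waiting type with at least the reciprocal of the
number of waiting processes as its probability. -/
structure IsPickingStep (S : PBPP Γ) (step : Config Γ → PMF (Config Γ)) : Prop where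
  zero : step 0 = PMF.pure 0
  pick : ∀ α ≠ 0, ∃ p : PMF Γ, step α = p.bind (S.fire α) ∧ (∀ X, p X ≠ 0 → 1 ≤ α X) ∧
    ∀ X, 1 ≤ α X → ((∑ Y, α Y : ℕ) : ℝ≥0∞)⁻¹ ≤ p X

theorem isPickingStep_stepType (S : PBPP Γ) : IsPickingStep S S.stepType where
  zero := by simp [stepType]
  pick α hα := by
    refine ⟨pickType α hα, by simp [stepType, hα], fun X hX => ?_, fun X hX => ?_⟩
    · by_contra h
      exact hX (PMF.uniformOfFinset_apply_of_notMem _ (by simpa using h))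
    · rw [pickType, PMF.uniformOfFinset_apply_of_mem _ (by simpa using hX)]
      gcongr
      rw [Finset.card_eq_sum_ones, Finset.sum_filter]
      exact Finset.sum_le_sum fun Y _ => by split_ifs <;> omega

theorem isPickingStep_stepProc (S : PBPP Γ) : IsPickingStep S S.stepProc where
  zero := by simp [stepProc]
  pick α hα := by
    refine ⟨pickProc α hα, by simp [stepProc, hα], fun X hX => ?_, fun X hX => ?_⟩
    · by_contra h
      have h0 : α X = 0 := by omega
      exact hX (by simp [pickProc, h0])
    · rw [pickProc, PMF.ofFintype_apply, div_eq_mul_inv, Nat.cast_sum]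
      exact le_mul_of_one_le_left zero_le (by exact_mod_cast hX)

omit [DecidableEq Γ] in
theorem exists_sum_rules_le (S : PBPP Γ) : ∃ c : ℕ, ∀ X, ∀ β ∈ S.rules X, ∑ Y, β Y ≤ c :=
  ⟨Finset.univ.sup fun X => (S.rules X).sup fun β => ∑ Y, β Y, fun X _ hβ =>
    (Finset.le_sup (f := fun β : Config Γ => ∑ Y, β Y) hβ).trans
      (Finset.le_sup (f := fun X => (S.rules X).sup fun β => ∑ Y, β Y) (Finset.mem_univ X))⟩

omit [Fintype Γ] [DecidableEq Γ] in
theorem ne_zero_of_one_le {α : Config Γ} {X : Γ} (h : 1 ≤ α X) : α ≠ 0 := by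
  rintro rfl; simp at h

variable {S : PBPP Γ} {Q : Finset Γ} {step : Config Γ → PMF (Config Γ)}

omit [Fintype Γ] in
theorem tsum_fire_mul_le {f : Config Γ → ℝ≥0∞} (hf : ∀ α, f α ≤ 1) {α β : Config Γ}
    {X : Γ} {ε : ℝ≥0∞} (hε : ε ≤ 1) (h : f (α - Pi.single X 1 + β) ≤ 1 - ε) :
    ∑' α', S.fire α X α' * f α' ≤ 1 - S.rhs X β * ε := by
  unfold fire
  rw [tsum_pmf_map_mul]
  exact tsum_pmf_mul_le_one_sub _ (fun _ => hf _) hε h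

/-- Induction along a path from `X` to `Q`. A waiting `X` is eventually picked almost surely or `Q`
is hit earlier; when it is picked, the rule leading towards `Q` fires with its fixed probability.
Hence `ε` is the product of the rule probabilities along the path, whatever the configuration. -/
theorem IsPickingStep.avoidForever_le (hs : IsPickingStep S step) {X : Γ}
    (hX : CanReach S Q X) : ∃ ε, ε ≠ 0 ∧ ε ≤ 1 ∧ ∀ h α, 1 ≤ α X →
      avoidForever (fun _ s => step s) (qStates Q) h α ≤ 1 - ε := by
  induction hX with
  | target hQ =>
    exact ⟨1, one_ne_zero, le_rfl, fun h α hα =>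
      (avoidForever_of_mem (mem_qStates.2 ⟨_, hQ, hα⟩) h).le.trans zero_le⟩
  | @step X Y β hβ hY _ ih =>
    obtain ⟨ε, h0, h1, ih⟩ := ih
    obtain ⟨c, hc⟩ := exists_sum_rules_le S
    refine ⟨S.rhs X β * ε, mul_ne_zero (S.rhs_ne_zero_iff.2 hβ) h0,
      mul_le_one' (PMF.coe_le_one _ _) h1, ?_⟩
    -- The error bounds the probability that `X` is not picked within `n` steps. Here `s` only
    -- bounds the number of processes from above, so that replacing it by `s + c` covers every
    -- possible successor.
    have key : ∀ n s h α, 1 ≤ α X → ∑ Z, α Z ≤ s →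
        avoidForever (fun _ s => step s) (qStates Q) h α ≤
          1 - S.rhs X β * ε + harmonicDecay c n s := by
      intro n
      induction n with
      | zero =>
        intro s h α _ _
        refine (avoidForever_le_one _ _).trans (le_add_left ?_)
        simp [harmonicDecay]
      | succ n ihn =>
        intro s h α hα hsum
        by_cases hF : α ∈ qStates Q
        · rw [avoidForever_of_mem hF]; exact zero_le
        obtain ⟨p, hp, hp1, hp2⟩ := hs.pick α (ne_zero_of_one_le hα)
        have hs1 : 1 ≤ ∑ Z, α Z :=
          hα.trans (Finset.single_le_sum (f := α) (fun _ _ => Nat.zero_le _) (Finset.mem_univ X))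
        rw [avoidForever_eq hF, hp, tsum_pmf_bind_mul]
        -- If another type is picked, `X` keeps waiting and the configuration gains at most `c`
        -- processes.
        refine (tsum_pmf_mul_le_add p (a₀ := X) (b := 1 - S.rhs X β * ε)
          (R := harmonicDecay c n (s + c)) ENNReal.ofReal_ne_top ?_ ?_).trans ?_
        · refine tsum_fire_mul_le (fun _ => avoidForever_le_one _ _) h1 (ih _ _ ?_)
          simp; omega
        · intro Z hZ hne
          refine tsum_pmf_mul_le fun α' hα' => ihn _ _ _
            (hα.trans (le_of_fire_ne_zero hα' (Ne.symm hne))) ?_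
          obtain ⟨β', hβ', rfl⟩ := mem_support_fire hα'
          simp only [Pi.add_apply, Finset.sum_add_distrib]
          refine add_le_add (le_trans (Finset.sum_le_sum fun W _ => ?_) hsum) (hc _ _ hβ')
          simp
        · gcongr
          refine le_trans ?_ (one_sub_inv_mul_harmonicDecay_le c n (hs1.trans hsum))
          gcongr
          refine le_trans ?_ (hp2 X hα)
          gcongr
    intro h α hα
    have hs1 : 1 ≤ ∑ Z, α Z :=
      hα.trans (Finset.single_le_sum (f := α) (fun _ _ => Nat.zero_le _) (Finset.mem_univ X))
    have := le_iInf fun n => key n _ h α hα le_rfl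
    rwa [← ENNReal.add_iInf, iInf_harmonicDecay c hs1, add_zero] at this

/-- There are finitely many types, so one `ε` works for all of them, and the presence of an almost
sure type is invariant until `Q` is hit. -/
theorem IsPickingStep.avoidForever_eq_zero (hs : IsPickingStep S step) {α : Config Γ}
    (hα : HasAlmostSure S Q α) (h : List (Config Γ)) :
    avoidForever (fun _ s => step s) (qStates Q) h α = 0 := by
  obtain ⟨ε, h0, hε⟩ := exists_uniform_pos
    (P := fun (X : Γ) ε => CanReach S Q X → ∀ h α, 1 ≤ α X →
      avoidForever (fun _ s => step s) (qStates Q) h α ≤ 1 - ε)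
    (fun X ε ε' hle H hX h α hα => (H hX h α hα).trans (tsub_le_tsub_left hle 1))
    (fun X => by
      by_cases hX : CanReach S Q X
      · obtain ⟨ε, h0, -, h⟩ := hs.avoidForever_le hX
        exact ⟨ε, h0, fun _ => h⟩
      · exact ⟨1, one_ne_zero, fun h => absurd h hX⟩)
  refine PBPP.avoidForever_eq_zero (good := fun _ α => HasAlmostSure S Q α)
    (ENNReal.sub_lt_self ENNReal.one_ne_top one_ne_zero h0) ?_ ?_ h α hα
  · intro h α hα hF α' hα'
    have hα0 : α ≠ 0 := by
      obtain ⟨X, hX, -⟩ := hα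
      exact ne_zero_of_one_le hX
    obtain ⟨p, hp, -, -⟩ := hs.pick α hα0
    rw [hp, ← PMF.mem_support_iff, PMF.mem_support_bind_iff] at hα'
    obtain ⟨X, -, hX⟩ := hα'
    exact hα.fire hF hX
  · rintro h α ⟨X, hX, hX'⟩
    exact hε X hX'.canReach h α hX

theorem IsPickingStep.configWeight_le_avoidForever (hs : IsPickingStep S step) (n : ℕ)
    (h : List (Config Γ)) (α : Config Γ) :
    configWeight (typeWeight S Q n) α ≤ avoidForever (fun _ s => step s) (qStates Q) h α := by
  refine le_iInf fun m => le_avoid (g := fun _ α => configWeight (typeWeight S Q n) α)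
    (fun _ α => configWeight_le_one (typeWeight_le_one S Q n) α)
    (fun _ α hα => configWeight_of_mem_qStates hα n) (fun _ α hα => ?_) m h α
  by_cases h0 : α = 0
  · subst h0
    rw [hs.zero, tsum_pmf_pure_mul]
  · obtain ⟨p, hp, hp1, -⟩ := hs.pick α h0
    rw [hp, tsum_pmf_bind_mul]
    calc configWeight (typeWeight S Q n) α
        = ∑' X, p X * configWeight (typeWeight S Q n) α := by
          rw [ENNReal.tsum_mul_right, p.tsum_coe, one_mul]
      _ ≤ _ := by
          refine ENNReal.tsum_le_tsum fun X => ?_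
          by_cases hX : p X = 0
          · simp [hX]
          · gcongr
            exact configWeight_le_tsum_fire S Q n (hp1 X hX)
              fun hQ => hα (mem_qStates.2 ⟨X, hQ, hp1 X hX⟩)

/-- The almost sure hitting criterion for both Markov chains. -/
theorem IsPickingStep.markovProb_eq_one_iff (hs : IsPickingStep S step) (α : Config Γ) :
    markovProb step α (qStates Q) = 1 ↔ HasAlmostSure S Q α := by
  unfold markovProb
  rw [seqLaw_hit_eq_one_iff, tsum_pmf_pure_mul]
  refine ⟨fun h => ?_, fun h => hs.avoidForever_eq_zero h []⟩
  by_contra hα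
  obtain ⟨n, hn⟩ := exists_configWeight_ne_zero hα
  exact hn (le_antisymm ((hs.configWeight_le_avoidForever n [] α).trans h.le) zero_le)

end

end PBPP
end

noncomputable section

namespace PBPP

/-! ### Schedulers -/

section

variable {Γ : Type u} [Fintype Γ] [DecidableEq Γ] {S : PBPP Γ} {Q : Finset Γ}

theorem mdp_δ_sched (α : Config Γ) (X : Γ) : S.mdp.δ α (sched X) = S.fire α X := rfl

theorem mdp_δ_idle (α : Config Γ) : S.mdp.δ α idle = PMF.pure α := rfl

/-- The transition law of the run `s₀ a₁ s₁ a₂ …` under a scheduler. -/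
def runStep (σ : S.mdp.Scheduler) (h : List (Config Γ × Action Γ)) (sa : Config Γ × Action Γ) :
    PMF (Config Γ × Action Γ) :=
  (S.mdp.δ sa.1 sa.2).bind fun t => (σ.choose (h ++ [sa]) t).map (Prod.mk t)

theorem runStep_ne_zero_iff {σ : S.mdp.Scheduler} {h : List (Config Γ × Action Γ)}
    {sa sb : Config Γ × Action Γ} :
    runStep σ h sa sb ≠ 0 ↔ S.mdp.δ sa.1 sa.2 sb.1 ≠ 0 ∧ σ.choose (h ++ [sa]) sb.1 sb.2 ≠ 0 := by
  unfold runStep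
  rw [← PMF.mem_support_iff, PMF.mem_support_bind_iff]
  simp only [PMF.support_map, Set.mem_image, PMF.mem_support_iff]
  constructor
  · rintro ⟨t, ht, a, ha, rfl⟩
    exact ⟨ht, ha⟩
  · rintro ⟨h1, h2⟩
    exact ⟨sb.1, h1, sb.2, h2, rfl⟩

theorem tsum_runStep_mul (σ : S.mdp.Scheduler) (h : List (Config Γ × Action Γ))
    (sa : Config Γ × Action Γ) (f : Config Γ × Action Γ → ℝ≥0∞) :
    ∑' sb, runStep σ h sa sb * f sb =
      ∑' t, S.mdp.δ sa.1 sa.2 t * ∑' a, σ.choose (h ++ [sa]) t a * f (t, a) := by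
  unfold runStep
  rw [tsum_pmf_bind_mul]
  simp_rw [tsum_pmf_map_mul]

/-- The run prefixes whose last configuration is in `F_Q`. -/
def runTarget (Q : Finset Γ) : Set (Config Γ × Action Γ) := {sa | sa.1 ∈ qStates Q}

theorem prob_eq_one_iff (σ : S.mdp.Scheduler) (α : Config Γ) :
    σ.prob α (qStates Q) = 1 ↔
      ∑' a, σ.choose [] α a * avoidForever (runStep σ) (runTarget Q) [] (α, a) = 0 := by
  rw [← tsum_pmf_map_mul (σ.choose [] α) (Prod.mk α), ← seqLaw_hit_eq_one_iff]
  rfl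

theorem hasAlmostSure_of_prob_eq_one {σ : S.mdp.Scheduler} {α : Config Γ}
    (hσ : σ.prob α (qStates Q) = 1) : HasAlmostSure S Q α := by
  classical
  by_contra hα
  obtain ⟨n, hn⟩ := exists_configWeight_ne_zero hα
  set w := configWeight (typeWeight S Q n)
  -- The transition function is arbitrary on disabled actions, so the submartingale is set to 0
  -- there. Schedulers give such actions no mass, hence averaging over the action restores `w`.
  let g : List (Config Γ × Action Γ) → Config Γ × Action Γ → ℝ≥0∞ := fun _ sa =>
    if sa.2 ∈ S.mdp.En sa.1 then w sa.1 else 0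
  have hw : ∀ h t, ∑' a, σ.choose h t a * g h (t, a) = w t := by
    intro h t
    rw [← one_mul (w t), ← (σ.choose h t).tsum_coe, ← ENNReal.tsum_mul_right]
    refine tsum_congr fun a => ?_
    by_cases ha : σ.choose h t a = 0
    · simp [ha]
    · simp [g, σ.enabled h t a ha]
  have hg : ∀ h sa, g h sa ≤ avoidForever (runStep σ) (runTarget Q) h sa := by
    refine fun h sa => le_iInf fun m => le_avoid (g := g) ?_ ?_ ?_ m h sa
    · intro h sa
      dsimp only [g]
      split_ifs
      · exact configWeight_le_one (typeWeight_le_one S Q n) _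
      · exact zero_le
    · intro h sa hsa
      simp [g, w, configWeight_of_mem_qStates (S := S) hsa n]
    · rintro h ⟨s, a⟩ hsa
      rw [tsum_runStep_mul]
      change _ ≤ ∑' t, S.mdp.δ s a t * ∑' a', σ.choose (h ++ [(s, a)]) t a' *
        g (h ++ [(s, a)]) (t, a')
      simp_rw [hw]
      dsimp only [g]
      split_ifs with ha
      · obtain ⟨X, rfl, hX⟩ | ⟨rfl, rfl⟩ := ha
        · exact configWeight_le_tsum_fire S Q n hX fun hQ => hsa (mem_qStates.2 ⟨X, hQ, hX⟩)
        · rw [mdp_δ_idle, tsum_pmf_pure_mul]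
      · exact zero_le
  rw [prob_eq_one_iff] at hσ
  refine hn (le_antisymm (le_trans ?_ hσ.le) zero_le)
  rw [← hw []]
  gcongr
  exact hg _ _

/-! ### Fair schedulers hit the target from almost sure types -/

/-- The run prefixes all of whose steps have positive probability. -/
inductive Reachable (σ : S.mdp.Scheduler) :
    List (Config Γ × Action Γ) → Config Γ × Action Γ → Prop
  | init {sa : Config Γ × Action Γ} : σ.choose [] sa.1 sa.2 ≠ 0 → Reachable σ [] sa
  | step {h : List (Config Γ × Action Γ)} {sa sb : Config Γ × Action Γ} :
      Reachable σ h sa → runStep σ h sa sb ≠ 0 → Reachable σ (h ++ [sa]) sb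

theorem Reachable.enabled {σ : S.mdp.Scheduler} {h : List (Config Γ × Action Γ)}
    {sa : Config Γ × Action Γ} (hr : Reachable σ h sa) : sa.2 ∈ S.mdp.En sa.1 := by
  cases hr with
  | init h => exact σ.enabled _ _ _ h
  | step _ h => exact σ.enabled _ _ _ (runStep_ne_zero_iff.1 h).2

theorem ofFn_succ_eq_append {A : Type*} (run : ℕ → A) (n : ℕ) :
    (List.ofFn fun i : Fin (n + 1) => run i) = (List.ofFn fun i : Fin n => run i) ++ [run n] := by
  rw [List.ofFn_succ', List.concat_eq_append]
  rfl

theorem Reachable.step_ne_zero {σ : S.mdp.Scheduler} {h : List (Config Γ × Action Γ)}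
    {sa : Config Γ × Action Γ} (hr : Reachable σ h sa) (run : ℕ → Config Γ × Action Γ)
    (h1 : (List.ofFn fun i : Fin h.length => run i) = h) (h2 : run h.length = sa) :
    σ.choose [] (run 0).1 (run 0).2 ≠ 0 ∧
      ∀ i < h.length, runStep σ (List.ofFn fun j : Fin i => run j) (run i) (run (i + 1)) ≠ 0 := by
  induction hr with
  | init h =>
    subst h2
    exact ⟨h, fun i hi => absurd hi (by simp)⟩
  | @step h sa sb _ hs ih =>
    have e : (h ++ [sa]).length = h.length + 1 := by simp
    rw [e, ofFn_succ_eq_append] at h1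
    obtain ⟨h3, h4⟩ := List.append_inj h1 (by simp)
    rw [List.singleton_inj] at h4
    obtain ⟨h5, h6⟩ := ih h3 h4
    refine ⟨h5, fun i hi => ?_⟩
    rw [e] at hi h2
    rcases Nat.lt_succ_iff_lt_or_eq.1 hi with hi | rfl
    · exact h6 i hi
    · rw [h2, h3, h4]; exact hs

/-- A reachable run prefix extends to a run along a property that can be maintained. -/
theorem Reachable.exists_run {σ : S.mdp.Scheduler} {h : List (Config Γ × Action Γ)}
    {sa : Config Γ × Action Γ} (hr : Reachable σ h sa)
    {P : List (Config Γ × Action Γ) → Config Γ × Action Γ → Prop} (hP : P h sa)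
    (next : ∀ h sa, P h sa → ∃ sb, runStep σ h sa sb ≠ 0 ∧ P (h ++ [sa]) sb) :
    ∃ run, σ.Produces run ∧ run h.length = sa ∧
      ∀ j, h.length ≤ j → P (List.ofFn fun i : Fin j => run i) (run j) := by
  let T := {z : List (Config Γ × Action Γ) × (Config Γ × Action Γ) // P z.1 z.2}
  choose f hf1 hf2 using fun z : T => next z.1.1 z.1.2 z.2
  let z : ℕ → T := fun n => Nat.rec ⟨(h, sa), hP⟩ (fun _ z => ⟨(z.1.1 ++ [z.1.2], f z), hf2 z⟩) n
  have hz : ∀ n, (z (n + 1)).1 = ((z n).1.1 ++ [(z n).1.2], f (z n)) := fun n => rfl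
  -- The run is `h`, then `sa`, then the successors chosen by iterating `f`.
  let run : ℕ → Config Γ × Action Γ := fun i =>
    if hi : i < h.length then h[i] else (z (i - h.length)).1.2
  have run_add : ∀ j, run (h.length + j) = (z j).1.2 := fun j => by simp [run]
  have prefix_eq : ∀ j, (List.ofFn fun i : Fin (h.length + j) => run i) = (z j).1.1 := by
    intro j
    induction j with
    | zero =>
      refine List.ext_getElem (by simp [z]) fun i h1 h2 => ?_
      simp [run, z]
    | succ j ih => rw [← add_assoc, ofFn_succ_eq_append, ih, run_add, hz]
  have h0 : run h.length = sa := run_add 0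
  obtain ⟨hi, hs⟩ := hr.step_ne_zero run (prefix_eq 0) h0
  have step : ∀ i, runStep σ (List.ofFn fun j : Fin i => run j) (run i) (run (i + 1)) ≠ 0 := by
    intro i
    by_cases hlt : i < h.length
    · exact hs i hlt
    · obtain ⟨j, rfl⟩ := Nat.exists_eq_add_of_le (not_lt.1 hlt)
      rw [prefix_eq, run_add, add_assoc, run_add, hz]
      exact hf1 (z j)
  refine ⟨run, fun i => ⟨?_, (runStep_ne_zero_iff.1 (step i)).1⟩, h0, fun j hj => ?_⟩
  · cases i with
    | zero => exact hi
    | succ i =>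
      rw [ofFn_succ_eq_append]
      exact (runStep_ne_zero_iff.1 (step i)).2
  · obtain ⟨j, rfl⟩ := Nat.exists_eq_add_of_le hj
    rw [prefix_eq, run_add]
    exact (z j).2

omit [Fintype Γ] in
theorem fire_ne_zero {X : Γ} {β : Config Γ} (hβ : β ∈ S.rules X) (α : Config Γ) :
    S.fire α X (α - Pi.single X 1 + β) ≠ 0 := by
  unfold fire
  rw [← PMF.mem_support_iff, PMF.support_map]
  exact ⟨β, S.rhs_ne_zero_iff.2 hβ, rfl⟩

theorem Reachable.exists_sched {σ : S.mdp.Scheduler} {h : List (Config Γ × Action Γ)}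
    {sa : Config Γ × Action Γ} (hr : Reachable σ h sa) {X : Γ} (hX : 1 ≤ sa.1 X) :
    ∃ Z, sa.2 = sched Z := by
  obtain ⟨Z, hZ, -⟩ | ⟨-, h0⟩ := hr.enabled
  · exact ⟨Z, hZ⟩
  · exact absurd h0 (ne_zero_of_one_le hX)

/-- Suppose the bound fails while `X` waits. Then `X` is not being scheduled, since scheduling it
would give the bound by induction along the path to `Q`. By averaging, some successor violates the
bound too, and `X` still waits there. Iterating yields a produced run that never schedules `X`,
against fairness. -/
theorem FairScheduler.avoidForever_le {k : ℕ} {σ : S.mdp.Scheduler} (hσ : FairScheduler k σ)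
    {X : Γ} (hX : CanReach S Q X) : ∃ ε, ε ≠ 0 ∧ ε ≤ 1 ∧ ∀ h sa, Reachable σ h sa →
      1 ≤ sa.1 X → avoidForever (runStep σ) (runTarget Q) h sa ≤ 1 - ε := by
  induction hX with
  | target hQ =>
    exact ⟨1, one_ne_zero, le_rfl, fun h sa _ hα =>
      (avoidForever_of_mem (F := runTarget Q) (mem_qStates.2 ⟨_, hQ, hα⟩) h).le.trans zero_le⟩
  | @step X Y β hβ hY _ ih =>
    obtain ⟨ε, h0, h1, ih⟩ := ih
    refine ⟨S.rhs X β * ε, mul_ne_zero (S.rhs_ne_zero_iff.2 hβ) h0,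
      mul_le_one' (PMF.coe_le_one _ _) h1, ?_⟩
    intro h sa hr hα
    by_contra hlt
    let P : List (Config Γ × Action Γ) → Config Γ × Action Γ → Prop := fun h sa =>
      Reachable σ h sa ∧ 1 ≤ sa.1 X ∧
        ¬ avoidForever (runStep σ) (runTarget Q) h sa ≤ 1 - S.rhs X β * ε
    have mem : ∀ h sa, P h sa → sa ∉ runTarget Q := fun h sa hP hsa =>
      hP.2.2 ((avoidForever_of_mem hsa h).le.trans zero_le)
    have ne : ∀ h sa, P h sa → sa.2 ≠ sched X := by
      rintro h ⟨s, a⟩ hP rfl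
      refine hP.2.2 ?_
      rw [avoidForever_eq (mem _ _ hP), tsum_runStep_mul]
      change ∑' t, S.fire s X t * _ ≤ _
      refine tsum_fire_mul_le (f := fun t => ∑' a, σ.choose (h ++ [(s, sched X)]) t a *
        avoidForever (runStep σ) (runTarget Q) (h ++ [(s, sched X)]) (t, a))
        (fun t => tsum_pmf_mul_le fun _ _ => avoidForever_le_one _ _) h1 ?_
      refine tsum_pmf_mul_le fun a ha => ih _ _ (hP.1.step (runStep_ne_zero_iff.2 ⟨?_, ha⟩)) ?_
      · exact fire_ne_zero hβ s
      · simp; omega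
    obtain ⟨run, hrun, h2, h3⟩ := hr.exists_run (P := P) ⟨hr, hα, hlt⟩ (by
      intro h sa hP
      by_contra! hno
      refine hP.2.2 ?_
      rw [avoidForever_eq (mem _ _ hP)]
      refine tsum_pmf_mul_le fun sb hsb => ?_
      by_contra hlt
      obtain ⟨Z, hZ⟩ := hP.1.exists_sched hP.2.1
      refine hno sb hsb ⟨hP.1.step hsb, hP.2.1.trans ?_, hlt⟩
      have h4 := (runStep_ne_zero_iff.1 hsb).1
      rw [hZ, mdp_δ_sched] at h4
      refine le_of_fire_ne_zero h4 ?_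
      rintro rfl
      exact ne _ _ hP hZ)
    obtain ⟨j, hj, -, hj2⟩ := hσ run hrun h.length X (by rw [h2]; exact hα)
    exact ne _ _ (h3 j hj) hj2

theorem FairScheduler.prob_eq_one {k : ℕ} {σ : S.mdp.Scheduler} (hσ : FairScheduler k σ)
    {α : Config Γ} (hα : HasAlmostSure S Q α) : σ.prob α (qStates Q) = 1 := by
  obtain ⟨ε, h0, hε⟩ := exists_uniform_pos
    (P := fun (X : Γ) ε => CanReach S Q X → ∀ h sa, Reachable σ h sa → 1 ≤ sa.1 X →
      avoidForever (runStep σ) (runTarget Q) h sa ≤ 1 - ε)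
    (fun X ε ε' hle H hX h sa hr hα => (H hX h sa hr hα).trans (tsub_le_tsub_left hle 1))
    (fun X => by
      by_cases hX : CanReach S Q X
      · obtain ⟨ε, h0, -, h⟩ := hσ.avoidForever_le hX
        exact ⟨ε, h0, fun _ => h⟩
      · exact ⟨1, one_ne_zero, fun h => absurd h hX⟩)
  rw [prob_eq_one_iff, ENNReal.tsum_eq_zero]
  intro a
  by_cases ha : σ.choose [] α a = 0
  · simp [ha]
  refine mul_eq_zero_of_right _ (avoidForever_eq_zero
    (good := fun h sa => Reachable σ h sa ∧ HasAlmostSure S Q sa.1)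
    (ENNReal.sub_lt_self ENNReal.one_ne_top one_ne_zero h0) ?_ ?_ _ _ ⟨Reachable.init ha, hα⟩)
  · rintro h sa ⟨hr, hs⟩ hF sb hsb
    refine ⟨hr.step hsb, ?_⟩
    obtain ⟨Z, hZ⟩ := hr.exists_sched hs.choose_spec.1
    have h4 := (runStep_ne_zero_iff.1 hsb).1
    rw [hZ, mdp_δ_sched] at h4
    exact hs.fire hF h4
  · rintro h sa ⟨hr, X, hX, hs⟩
    exact hε X hs.canReach h sa hr hX

/-! ### The scheduler that picks the least recently scheduled type -/

open Classical in
/-- One plus the last time at which `Y` was scheduled, and `0` if `Y` was never scheduled. -/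
def lastTime (h : List (Config Γ × Action Γ)) (Y : Γ) : ℕ :=
  (Finset.range h.length).sup fun j => if h[j]?.map Prod.snd = some (sched Y) then j + 1 else 0

omit [DecidableEq Γ] in
theorem exists_leastRecent (h : List (Config Γ × Action Γ)) {s : Config Γ} (hs : s ≠ 0) :
    ∃ X, 1 ≤ s X ∧ ∀ Y, 1 ≤ s Y → lastTime h X ≤ lastTime h Y := by
  obtain ⟨X, hX, hmin⟩ := Finset.exists_min_image _ (lastTime h) (waiting_nonempty hs)
  exact ⟨X, by simpa using hX, fun Y hY => hmin Y (by simpa using hY)⟩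

open Classical in
/-- The scheduler that picks the least recently scheduled type. -/
def leastRecent (S : PBPP Γ) : S.mdp.Scheduler where
  choose h s :=
    if hs : s = 0 then PMF.pure idle else PMF.pure (sched (exists_leastRecent h hs).choose)
  enabled h s a ha := by
    split_ifs at ha with hs
    · rw [← PMF.mem_support_iff, PMF.mem_support_pure_iff] at ha
      exact Or.inr ⟨ha, hs⟩
    · rw [← PMF.mem_support_iff, PMF.mem_support_pure_iff] at ha
      exact Or.inl ⟨_, ha, (exists_leastRecent h hs).choose_spec.1⟩

omit [Fintype Γ] [DecidableEq Γ] in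
-- Times are shifted by one, so a value at most `i` means that `X` was not scheduled at any index
-- from `i` on.
theorem lastTime_ofFn_le {run : ℕ → Config Γ × Action Γ} {i j : ℕ} {X : Γ}
    (h : ∀ m, i ≤ m → m < j → (run m).2 ≠ sched X) :
    lastTime (List.ofFn fun m : Fin j => run m) X ≤ i := by
  refine Finset.sup_le fun m hm => ?_
  have hm' : m < j := by simpa using hm
  split_ifs with he
  · simp only [List.getElem?_ofFn, hm', dif_pos, Option.map_some, Option.some.injEq] at he
    by_contra hlt
    exact h m (by omega) hm' he
  · exact Nat.zero_le _

omit [Fintype Γ] [DecidableEq Γ] in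
theorem lt_lastTime_ofFn {run : ℕ → Config Γ × Action Γ} {j m : ℕ} {X : Γ} (hm : m < j)
    (h : (run m).2 = sched X) : m < lastTime (List.ofFn fun m : Fin j => run m) X := by
  refine Nat.lt_of_succ_le (le_trans ?_ (Finset.le_sup (b := m) (by simpa using hm)))
  simp [hm, h]

/-- If `X` waits at time `i` and is ignored for `k` steps, each type picked in this window was
scheduled no more recently than `X`, hence not earlier in the window. The `k` picks are then
distinct and all differ from `X`, although there are at most `k` types. -/
theorem fairScheduler_leastRecent (S : PBPP Γ) {k : ℕ} (hk : Fintype.card Γ ≤ k) :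
    FairScheduler k (leastRecent S) := by
  intro run hrun i X hX
  by_contra! hno
  have wait : ∀ j, j < k → 1 ≤ (run (i + j)).1 X ∧ ∃ Y, (run (i + j)).2 = sched Y ∧
      lastTime (List.ofFn fun m : Fin (i + j) => run m) Y ≤ i := by
    intro j
    induction j with
    | zero =>
      intro hj
      refine ⟨hX, ?_⟩
      have h1 := (hrun i).1
      have hs := ne_zero_of_one_le hX
      simp only [leastRecent, hs, dif_neg, not_false_eq_true] at h1
      rw [← PMF.mem_support_iff, PMF.mem_support_pure_iff] at h1
      exact ⟨_, h1, lastTime_ofFn_le fun m h1 h2 => absurd h1 (not_le.2 h2)⟩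
    | succ j ih =>
      intro hj
      obtain ⟨h1, Y, hY, -⟩ := ih (by omega)
      have h2 := (hrun (i + j)).2
      rw [hY, mdp_δ_sched] at h2
      have hXY : X ≠ Y := by
        rintro rfl
        exact hno (i + j) (by omega) (by omega) hY
      have h3 : 1 ≤ (run (i + (j + 1))).1 X := h1.trans (le_of_fire_ne_zero h2 hXY)
      refine ⟨h3, ?_⟩
      have h4 := (hrun (i + (j + 1))).1
      have hs := ne_zero_of_one_le h3
      simp only [leastRecent, hs, dif_neg, not_false_eq_true] at h4
      rw [← PMF.mem_support_iff, PMF.mem_support_pure_iff] at h4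
      refine ⟨_, h4, ((exists_leastRecent _ hs).choose_spec.2 X h3).trans ?_⟩
      exact lastTime_ofFn_le fun m h1 h2 => hno m h1 (by omega)
  choose f hf hf2 using fun j : Fin k => (wait j j.2).2
  have inj : Function.Injective f := by
    intro a b hab
    by_contra hne
    wlog hlt : a < b generalizing a b
    · exact this hab.symm (Ne.symm hne) (lt_of_le_of_ne (not_lt.1 hlt) (Ne.symm hne))
    have h1 := hf2 b
    rw [← hab] at h1
    have := lt_lastTime_ofFn (j := i + b) (m := i + a) (by omega) (hf a)
    omega
  have nsurj : ¬ Function.Surjective f := by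
    intro hs
    obtain ⟨j, hj⟩ := hs X
    exact hno (i + j) (by omega) (by omega) (by rw [hf, hj])
  have := Fintype.card_lt_of_injective_not_surjective f inj nsurj
  simp at this
  omega

/-- All four almost sure coverability questions have the same answer. -/
theorem tfae_almostSure (S : PBPP Γ) (Q : Finset Γ) (α₀ : Config Γ) {k : ℕ}
    (hk : Fintype.card Γ ≤ k) : List.TFAE [
      HasAlmostSure S Q α₀,
      S.probType α₀ (qStates Q) = 1,
      S.probProc α₀ (qStates Q) = 1,
      ∃ σ : S.mdp.Scheduler, σ.prob α₀ (qStates Q) = 1,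
      ∀ σ : S.mdp.Scheduler, FairScheduler k σ → σ.prob α₀ (qStates Q) = 1] := by
  tfae_have 1 ↔ 2 := ((isPickingStep_stepType S).markovProb_eq_one_iff α₀).symm
  tfae_have 1 ↔ 3 := ((isPickingStep_stepProc S).markovProb_eq_one_iff α₀).symm
  tfae_have 1 → 5 := fun h σ hσ => hσ.prob_eq_one h
  -- The universal statement is not vacuous: `card Γ ≤ k` provides a `k`-fair scheduler.
  tfae_have 5 → 4 := fun h => ⟨_, h _ (fairScheduler_leastRecent S hk)⟩
  tfae_have 4 → 1 := fun ⟨_, hσ⟩ => hasAlmostSure_of_prob_eq_one hσ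
  tfae_finish

end

end PBPP
end

noncomputable section

namespace PBPP

/-! ### A stack machine for almost sure coverability -/

namespace Machine

open Computability (Γ')
open Turing

/-- The stacks: the input, the part of the rules that was read, the cells of the types, the cells
that were read, two round counters, and the output. -/
inductive Stack
  | input | read | cells | done | grow | shrink | output
  deriving DecidableEq

instance : Fintype Stack :=
  ⟨{.input, .read, .cells, .done, .grow, .shrink, .output}, fun x => by cases x <;> decide⟩

/-- The information on a type: whether it is a target type, whether it is present in the initial
configuration, whether it is marked, and whether it is the left-hand side of the current rule. -/
structure Cell where
  target : Bool
  start : Bool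
  mark : Bool
  lhs : Bool
  deriving DecidableEq, Fintype

/-- The part of the instance that is being read. -/
inductive Mode
  | set | start | lhs | rhs
  deriving DecidableEq

instance : Fintype Mode :=
  ⟨{.set, .start, .lhs, .rhs}, fun x => by cases x <;> decide⟩

/-- The program points. -/
inductive Label
  | bound | readSet | scan | rewind | skip₁ | skip₂ | rules | restore | round | finish | clean
  deriving DecidableEq

instance : Fintype Label :=
  ⟨{.bound, .readSet, .scan, .rewind, .skip₁, .skip₂, .rules, .restore, .round, .finish, .clean}, fun x => by cases x <;> decide⟩

/-- The alphabets of the stacks. -/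
abbrev Alph : Stack → Type
  | .input => Γ'
  | .read => Γ'
  | .cells => Cell
  | .done => Cell
  | .grow => Unit
  | .shrink => Unit
  | .output => Bool

/-- The internal state: the symbol and the cell that were popped last, the current mode, whether
the current number is known to be nonzero, whether the current right-hand side contains a marked
type, and whether marks are being added. -/
structure State where
  sym : Option Γ'
  cell : Option Cell
  mode : Mode
  nonzero : Bool
  hit : Bool
  growing : Bool
  deriving DecidableEq, Fintype

/-- The state at the beginning of each step. -/
def State.mk' (m : Mode) (z h g : Bool) : State := ⟨none, none, m, z, h, g⟩

/-- The cell with the information from the current number. -/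
def Cell.set (m : Mode) (z : Bool) (c : Cell) : Cell :=
  match m with
  | .start => { c with start := z }
  | .lhs => { c with lhs := z }
  | _ => c

/-- The state after a number. -/
def State.afterNumber (s : State) : State :=
  .mk' s.mode false
    (s.hit || (s.mode == .rhs && s.nonzero && (s.cell.map Cell.mark).getD false)) s.growing

/-- The cell after the current rule. -/
def Cell.update (m : Mode) (h g : Bool) (c : Cell) : Cell :=
  match m with
  -- When growing, a left-hand side is marked if its rule spawns a marked type. When shrinking, it
  -- loses its mark if the rule spawns none, unless it is a target. The left-hand side flag is
  -- cleared for the next rule.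
  | .rhs => ⟨c.target, c.start,
      if g then c.mark || (c.lhs && h) else c.mark && (!c.lhs || h || c.target), false⟩
  | _ => c

/-- A symbol is a bit. -/
def isBit : Option Γ' → Bool
  | some (.bit _) => true
  | _ => false

open TM2.Stmt in
/-- The program. -/
def program : Label → TM2.Stmt Alph Label State
  | .bound => pop .input (fun s a => { s with sym := a }) <|
      branch (fun s => s.sym == some .comma)
        (load (fun s => { s with sym := none }) <| goto fun _ => .readSet)
        (load (fun s => { s with sym := none }) <| goto fun _ => .bound)
  | .readSet => pop .input (fun s a => { s with sym := a }) <|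
      branch (fun s => isBit s.sym)
        -- Marks start as the target set. One token per type on each counter pays for `n` growing
        -- and `n` shrinking rounds.
        (push .done (fun s => ⟨s.sym == some (.bit true), false, s.sym == some (.bit true), false⟩) <|
          push .grow (fun _ => ()) <| push .shrink (fun _ => ()) <|
          load (fun s => { s with sym := none }) <| goto fun _ => .readSet) <|
      branch (fun s => s.sym == some .ket)
        (load (fun s => { s with sym := none }) <| goto fun _ => .rewind)
        (load (fun s => { s with sym := none }) <| goto fun _ => .readSet)
  | .rewind => pop .done (fun s c => { s with cell := c }) <|
      branch (fun s => s.cell.isSome)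
        (push .cells (fun s => (s.cell.getD ⟨false, false, false, false⟩).update s.mode s.hit s.growing) <|
          load (fun s => { s with cell := none }) <| goto fun _ => .rewind)
        (branch (fun s => s.mode == .set)
            (load (fun s => .mk' .start false s.hit s.growing) <| goto fun _ => .scan) <|
          branch (fun s => s.mode == .start) (goto fun _ => .round) <|
          branch (fun s => s.mode == .lhs)
            (load (fun s => .mk' .rhs false s.hit s.growing) <| goto fun _ => .scan)
            (goto fun _ => .skip₁))
  | .scan =>
      let body := branch (fun s => s.sym == some .comma)
        (pop .cells (fun s c => { s with cell := c }) <| push .done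
            (fun s => (s.cell.getD ⟨false, false, false, false⟩).set s.mode s.nonzero) <|
          load State.afterNumber <| goto fun _ => .scan) <|
        branch (fun s => s.sym == some .ket)
          (load (fun s => { s with sym := none }) <| goto fun _ => .rewind)
          (load (fun s => { s with sym := none, nonzero := s.nonzero || isBit s.sym }) <|
            goto fun _ => .scan)
      pop .input (fun s a => { s with sym := a }) <|
        -- The initial configuration is read only once, whereas the rules are copied to `read`
        -- because every round needs them again.
        branch (fun s => s.mode == .start) body (push .read (fun s => s.sym.getD .blank) body)
  | .skip₁ => pop .input (fun s a => { s with sym := a }) <|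
      push .read (fun s => s.sym.getD .blank) <|
      branch (fun s => s.sym == some .comma)
        (load (fun s => { s with sym := none }) <| goto fun _ => .skip₂)
        (load (fun s => { s with sym := none }) <| goto fun _ => .skip₁)
  | .skip₂ => pop .input (fun s a => { s with sym := a }) <|
      push .read (fun s => s.sym.getD .blank) <|
      branch (fun s => s.sym == some .comma)
        (load (fun s => { s with sym := none }) <| goto fun _ => .rules)
        (load (fun s => { s with sym := none }) <| goto fun _ => .skip₂)
  | .rules => peek .input (fun s a => { s with sym := a }) <|
      branch (fun s => s.sym.isSome)
        (load (fun s => .mk' .lhs false false s.growing) <| goto fun _ => .scan)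
        (load (fun s => .mk' .rhs false false s.growing) <| goto fun _ => .restore)
  | .restore => pop .read (fun s a => { s with sym := a }) <|
      branch (fun s => s.sym.isSome)
        (push .input (fun s => s.sym.getD .blank) <|
          load (fun s => { s with sym := none }) <| goto fun _ => .restore)
        (goto fun _ => .round)
  | .round => pop .grow (fun s a => { s with nonzero := a.isSome }) <|
      branch (fun s => s.nonzero)
        (load (fun _ => .mk' .rhs false false true) <| goto fun _ => .rules) <|
      pop .shrink (fun s a => { s with nonzero := a.isSome }) <|
      branch (fun s => s.nonzero)
        (load (fun _ => .mk' .rhs false false false) <| goto fun _ => .rules)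
        (load (fun _ => .mk' .rhs false false false) <| goto fun _ => .finish)
  | .finish => pop .cells (fun s c => { s with cell := c }) <|
      branch (fun s => s.cell.isSome)
        (load (fun s => .mk' .rhs false
            (s.hit || (s.cell.map fun c => c.start && c.mark).getD false) false) <|
          goto fun _ => .finish)
        (goto fun _ => .clean)
  | .clean => pop .input (fun s a => { s with sym := a }) <|
      branch (fun s => s.sym.isSome)
        (load (fun s => { s with sym := none }) <| goto fun _ => .clean)
        -- A halting configuration must have only the output stack nonempty and the internal state
        -- reset.
        (push .output (fun s => s.hit) <| load (fun _ => .mk' .set false false false) halt)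

/-- The machine; `l` is the entry point. -/
def machine (l : Label) : FinTM2 where
  k₀ := Stack.input
  k₁ := Stack.output
  Γ := Alph
  Λ := Label
  main := l
  σ := State
  initialState := .mk' .set false false false
  Γk₀Fin := inferInstanceAs (Fintype Γ')
  m := program

/-- The contents of the stacks, where the output is empty. -/
def memory (a b : List Γ') (v w : List Cell) (g s : List Unit) : ∀ k, List (Alph k)
  | .input => a
  | .read => b
  | .cells => v
  | .done => w
  | .grow => g
  | .shrink => s
  | .output => []

section

variable (a b : List Γ') (v w : List Cell) (g s : List Unit)

@[simp] theorem memory_input : memory a b v w g s .input = a := rfl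
@[simp] theorem memory_read : memory a b v w g s .read = b := rfl
@[simp] theorem memory_cells : memory a b v w g s .cells = v := rfl
@[simp] theorem memory_done : memory a b v w g s .done = w := rfl
@[simp] theorem memory_grow : memory a b v w g s .grow = g := rfl
@[simp] theorem memory_shrink : memory a b v w g s .shrink = s := rfl
@[simp] theorem update_input (a' : List Γ') :
    Function.update (memory a b v w g s) .input a' = memory a' b v w g s := by
  funext k; cases k <;> rfl
@[simp] theorem update_read (b' : List Γ') :
    Function.update (memory a b v w g s) .read b' = memory a b' v w g s := by
  funext k; cases k <;> rfl
@[simp] theorem update_cells (v' : List Cell) :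
    Function.update (memory a b v w g s) .cells v' = memory a b v' w g s := by
  funext k; cases k <;> rfl
@[simp] theorem update_done (w' : List Cell) :
    Function.update (memory a b v w g s) .done w' = memory a b v w' g s := by
  funext k; cases k <;> rfl
@[simp] theorem update_grow (g' : List Unit) :
    Function.update (memory a b v w g s) .grow g' = memory a b v w g' s := by
  funext k; cases k <;> rfl
@[simp] theorem update_shrink (s' : List Unit) :
    Function.update (memory a b v w g s) .shrink s' = memory a b v w g s' := by
  funext k; cases k <;> rfl

end

/-- The machine gets from `c` to `c'` in at most `t` steps. -/
def Runs (t : ℕ) (c c' : TM2.Cfg Alph Label State) : Prop :=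
  ∃ n ≤ t, (flip bind (TM2.step program))^[n] (some c) = some c'

theorem Runs.refl (t : ℕ) (c : TM2.Cfg Alph Label State) : Runs t c c := ⟨0, Nat.zero_le _, rfl⟩

theorem Runs.trans {t₁ t₂ t : ℕ} {c₁ c₂ c₃ : TM2.Cfg Alph Label State} (h₁ : Runs t₁ c₁ c₂)
    (h₂ : Runs t₂ c₂ c₃) (ht : t₁ + t₂ ≤ t) : Runs t c₁ c₃ := by
  obtain ⟨n₁, hn₁, e₁⟩ := h₁
  obtain ⟨n₂, hn₂, e₂⟩ := h₂
  exact ⟨n₂ + n₁, by omega, by rw [Function.iterate_add_apply, e₁, e₂]⟩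

theorem Runs.head {t t' : ℕ} {c₁ c₂ c₃ : TM2.Cfg Alph Label State}
    (h₁ : TM2.step program c₁ = some c₂) (h₂ : Runs t c₂ c₃) (ht : t + 1 ≤ t') : Runs t' c₁ c₃ :=
  Runs.trans ⟨1, le_rfl, h₁⟩ h₂ (by omega)

theorem Runs.of_eq {t t' : ℕ} {c c₁ c₂ : TM2.Cfg Alph Label State} (h : Runs t c c₁)
    (e : c₁ = c₂) (ht : t ≤ t') : Runs t' c c₂ :=
  e ▸ h.trans (Runs.refl 0 _) ht

/-- A configuration that has not halted. -/
def cfg (l : Label) (m : Mode) (z h gr : Bool) (a b : List Γ') (v w : List Cell)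
    (g s : List Unit) : TM2.Cfg Alph Label State :=
  ⟨some l, .mk' m z h gr, memory a b v w g s⟩

variable {m : Mode} {z h gr : Bool} {a b : List Γ'} {v w : List Cell} {g s : List Unit}

theorem runs_bound (bs : List Bool) :
    Runs (bs.length + 1) (cfg .bound m z h gr (bs.map Γ'.bit ++ Γ'.comma :: a) b v w g s)
      (cfg .readSet m z h gr a b v w g s) := by
  induction bs with
  | nil =>
    refine Runs.head (t := 0) ?_ (Runs.refl _ _) le_rfl
    simp [cfg, program, State.mk']
  | cons x bs ih =>
    refine Runs.head ?_ ih le_rfl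
    simp [cfg, program, State.mk']
    rfl

theorem runs_skip₁ (bs : List Bool) :
    Runs (bs.length + 1) (cfg .skip₁ m z h gr (bs.map Γ'.bit ++ Γ'.comma :: a) b v w g s)
      (cfg .skip₂ m z h gr a ((bs.map Γ'.bit ++ [Γ'.comma]).reverse ++ b) v w g s) := by
  induction bs generalizing b with
  | nil =>
    refine Runs.head (t := 0) ?_ (Runs.refl _ _) le_rfl
    simp [cfg, program, State.mk']
  | cons x bs ih =>
    have := ih (b := Γ'.bit x :: b)
    simp only [List.map_cons, List.cons_append, List.reverse_cons, List.append_assoc] at this ⊢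
    refine Runs.head ?_ this le_rfl
    simp [cfg, program, State.mk']
    rfl

theorem runs_skip₂ (bs : List Bool) :
    Runs (bs.length + 1) (cfg .skip₂ m z h gr (bs.map Γ'.bit ++ Γ'.comma :: a) b v w g s)
      (cfg .rules m z h gr a ((bs.map Γ'.bit ++ [Γ'.comma]).reverse ++ b) v w g s) := by
  induction bs generalizing b with
  | nil =>
    refine Runs.head (t := 0) ?_ (Runs.refl _ _) le_rfl
    simp [cfg, program, State.mk']
  | cons x bs ih =>
    have := ih (b := Γ'.bit x :: b)
    simp only [List.map_cons, List.cons_append, List.reverse_cons, List.append_assoc] at this ⊢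
    refine Runs.head ?_ this le_rfl
    simp [cfg, program, State.mk']
    rfl

theorem runs_readSet (bs : List Bool) :
    Runs (bs.length + 1) (cfg .readSet m z h gr (bs.map Γ'.bit ++ Γ'.ket :: a) b v w g s)
      (cfg .rewind m z h gr a b v ((bs.map fun x => ⟨x, false, x, false⟩).reverse ++ w)
        (List.replicate bs.length () ++ g) (List.replicate bs.length () ++ s)) := by
  induction bs generalizing w g s with
  | nil =>
    refine Runs.head (t := 0) ?_ (Runs.refl _ _) le_rfl
    simp [cfg, program, State.mk', isBit]
  | cons x bs ih =>
    have := ih (w := ⟨x, false, x, false⟩ :: w) (g := () :: g) (s := () :: s)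
    have e : ∀ l : List Unit, List.replicate (x :: bs).length () ++ l =
        List.replicate bs.length () ++ () :: l := fun l => by
      simp [List.replicate_succ', List.append_assoc]
    rw [e, e]
    simp only [List.map_cons, List.cons_append, List.reverse_cons, List.append_assoc,
      List.nil_append] at this ⊢
    refine Runs.head ?_ this le_rfl
    cases x <;> simp [cfg, program, State.mk', isBit] <;> rfl

/-- The program point and the mode after rewinding. -/
def afterRewind : Mode → Label × Mode
  | .set => (.scan, .start)
  | .start => (.round, .start)
  | .lhs => (.scan, .rhs)
  | .rhs => (.skip₁, .rhs)

theorem runs_rewind :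
    Runs (w.length + 1) (cfg .rewind m false h gr a b v w g s)
      (cfg (afterRewind m).1 (afterRewind m).2 false h gr a b
        ((w.map (Cell.update m h gr)).reverse ++ v) [] g s) := by
  induction w generalizing v with
  | nil =>
    refine Runs.head (t := 0) ?_ (Runs.refl _ _) le_rfl
    cases m <;> simp [cfg, program, State.mk', afterRewind] <;> rfl
  | cons c w ih =>
    have := ih (v := c.update m h gr :: v)
    simp only [List.map_cons, List.reverse_cons, List.append_assoc, List.cons_append,
      List.nil_append] at this ⊢
    refine Runs.head ?_ this le_rfl
    simp [cfg, program, State.mk']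

/-- The stack of the symbols that were read after a number or configuration was read. -/
def pushRead (m : Mode) (l b : List Γ') : List Γ' := if m = .start then b else l.reverse ++ b

theorem pushRead_pushRead (m : Mode) (l l' b : List Γ') :
    pushRead m l' (pushRead m l b) = pushRead m (l ++ l') b := by
  unfold pushRead; split_ifs <;> simp

theorem step_scan_comma (c : Cell) :
    TM2.step program (cfg .scan m z h gr (Γ'.comma :: a) b (c :: v) w g s) =
      some (cfg .scan m false (h || (m == .rhs && z && c.mark)) gr a (pushRead m [Γ'.comma] b) v
        (c.set m z :: w) g s) := by
  cases m <;> simp [cfg, program, State.mk', State.afterNumber, pushRead] <;> rfl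

theorem step_scan_bit (x : Bool) :
    TM2.step program (cfg .scan m z h gr (Γ'.bit x :: a) b v w g s) =
      some (cfg .scan m true h gr a (pushRead m [Γ'.bit x] b) v w g s) := by
  cases m <;> cases x <;> simp [cfg, program, State.mk', pushRead, isBit] <;> rfl

theorem step_scan_bra :
    TM2.step program (cfg .scan m z h gr (Γ'.bra :: a) b v w g s) =
      some (cfg .scan m z h gr a (pushRead m [Γ'.bra] b) v w g s) := by
  cases m <;> simp [cfg, program, State.mk', pushRead, isBit] <;> rfl

theorem step_scan_ket :
    TM2.step program (cfg .scan m z h gr (Γ'.ket :: a) b v w g s) =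
      some (cfg .rewind m z h gr a (pushRead m [Γ'.ket] b) v w g s) := by
  cases m <;> simp [cfg, program, State.mk', pushRead] <;> rfl

end Machine

end PBPP
end

/-! ### Scanning numbers, configurations and rules -/

noncomputable section

namespace PBPP

namespace Machine

open Computability (Γ')
open Turing

variable {m : Mode} {z h gr : Bool} {a b : List Γ'} {v w : List Cell} {g s : List Unit}

theorem runs_bits (bs : List Bool) (c : Cell) :
    Runs (bs.length + 1)
      (cfg .scan m z h gr (bs.map Γ'.bit ++ [Γ'.comma] ++ a) b (c :: v) w g s)
      (cfg .scan m false (h || (m == .rhs && (z || !bs.isEmpty) && c.mark)) gr a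
        (pushRead m (bs.map Γ'.bit ++ [Γ'.comma]) b) v (c.set m (z || !bs.isEmpty) :: w) g s) := by
  induction bs generalizing z b with
  | nil =>
    refine Runs.head (t := 0) (step_scan_comma c) ?_ le_rfl
    simpa using Runs.refl _ _
  | cons x bs ih =>
    refine Runs.head (step_scan_bit x) ?_ le_rfl
    have := ih (z := true) (b := pushRead m [Γ'.bit x] b)
    rw [pushRead_pushRead] at this
    simpa using this

/-- Zero is encoded by the empty word, so the machine tests positivity by looking for a bit before
the separator. -/
theorem isEmpty_encodeNat (k : ℕ) :
    (!(Computability.encodeNat k).isEmpty) = decide (k ≠ 0) := by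
  by_cases hk : k = 0
  · subst hk; rfl
  · have : Computability.encodeNat k ≠ [] := fun h => hk (by
      rw [← Computability.decode_encodeNat k, h]; rfl)
    simp [hk, this]

theorem runs_number (k : ℕ) (c : Cell) :
    Runs (encNat k).length (cfg .scan m false h gr (encNat k ++ a) b (c :: v) w g s)
      (cfg .scan m false (h || (m == .rhs && (decide (k ≠ 0) && c.mark))) gr a
        (pushRead m (encNat k) b) v (c.set m (decide (k ≠ 0)) :: w) g s) := by
  have := runs_bits (m := m) (z := false) (h := h) (gr := gr) (a := a) (b := b) (v := v) (w := w)
    (g := g) (s := s) (Computability.encodeNat k) c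
  rw [Bool.false_or, isEmpty_encodeNat, Bool.and_assoc] at this
  simpa [encNat] using this

theorem runs_numbers {A : Type*} (α : A → ℕ) (f : A → Cell) (l : List A) :
    Runs (l.flatMap fun X => encNat (α X)).length
      (cfg .scan m false h gr ((l.flatMap fun X => encNat (α X)) ++ a) b (l.map f ++ v) w g s)
      (cfg .scan m false
        (h || (m == .rhs && l.any fun X => decide (α X ≠ 0) && (f X).mark)) gr a
        (pushRead m (l.flatMap fun X => encNat (α X)) b) v
        ((l.map fun X => (f X).set m (decide (α X ≠ 0))).reverse ++ w) g s) := by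
  induction l generalizing h b w with
  | nil =>
    have : pushRead m [] b = b := by simp [pushRead]
    simpa [this] using Runs.refl 0 _
  | cons X l ih =>
    simp only [List.flatMap_cons, List.append_assoc, List.map_cons, List.cons_append,
      List.reverse_cons, List.length_append, List.any_cons]
    refine (runs_number (α X) (f X)).trans ?_ le_rfl
    have := ih (h := h || (m == .rhs && (decide (α X ≠ 0) && (f X).mark)))
      (b := pushRead m (encNat (α X)) b) (w := (f X).set m (decide (α X ≠ 0)) :: w)
    rw [pushRead_pushRead] at this
    simpa only [Bool.and_or_distrib_left, Bool.or_assoc, List.nil_append] using this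

theorem runs_encConfig {n : ℕ} (α : Config (Fin n)) (f : Fin n → Cell) {h' : Bool}
    (hh : h' = (h || (m == .rhs &&
      (List.finRange n).any fun X => decide (α X ≠ 0) && (f X).mark))) :
    Runs ((encConfig α).length + (n + 1))
      (cfg .scan m false h gr (encConfig α ++ a) b ((List.finRange n).map f) [] g s)
      (cfg (afterRewind m).1 (afterRewind m).2 false h' gr a (pushRead m (encConfig α) b)
        ((List.finRange n).map fun X => ((f X).set m (decide (α X ≠ 0))).update m h' gr) [] g s) := by
  subst hh
  have h1 := runs_numbers (m := m) (h := h) (gr := gr) (a := Γ'.ket :: a)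
    (b := pushRead m [Γ'.bra] b) (v := []) (w := []) (g := g) (s := s) α f (List.finRange n)
  have h2 := Runs.trans h1 (Runs.head step_scan_ket (runs_rewind (v := [])) le_rfl) le_rfl
  have h3 := Runs.head step_scan_bra h2 le_rfl
  rw [pushRead_pushRead, pushRead_pushRead] at h3
  simp only [encConfig, List.append_assoc, List.cons_append, List.nil_append, List.append_nil]
    at h3 ⊢
  simp only [List.map_reverse, List.reverse_reverse, List.map_map, List.length_reverse,
    List.length_map, List.length_finRange] at h3
  refine Runs.trans h3 (Runs.refl 0 _) ?_
  simp only [List.length_cons, List.length_append, List.length_nil]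
  omega

theorem runs_skip_encNat (k : ℕ) :
    Runs (encNat k).length (cfg .skip₁ m z h gr (encNat k ++ a) b v w g s)
      (cfg .skip₂ m z h gr a ((encNat k).reverse ++ b) v w g s) ∧
    Runs (encNat k).length (cfg .skip₂ m z h gr (encNat k ++ a) b v w g s)
      (cfg .rules m z h gr a ((encNat k).reverse ++ b) v w g s) := by
  have h1 := runs_skip₁ (m := m) (z := z) (h := h) (gr := gr) (a := a) (b := b) (v := v) (w := w)
    (g := g) (s := s) (Computability.encodeNat k)
  have h2 := runs_skip₂ (m := m) (z := z) (h := h) (gr := gr) (a := a) (b := b) (v := v) (w := w)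
    (g := g) (s := s) (Computability.encodeNat k)
  simp only [encNat, List.append_assoc, List.length_append, List.length_map, List.length_singleton,
    List.singleton_append]
  exact ⟨h1, h2⟩

theorem step_rules_cons (x : Γ') :
    TM2.step program (cfg .rules m z h gr (x :: a) b v w g s) =
      some (cfg .scan .lhs false false gr (x :: a) b v w g s) := by
  simp [cfg, program, State.mk']

theorem step_rules_nil :
    TM2.step program (cfg .rules m z h gr [] b v w g s) =
      some (cfg .restore .rhs false false gr [] b v w g s) := by
  simp [cfg, program, State.mk']

/-- The cells between two rules. -/
def cells {n : ℕ} (q st mk : Fin n → Bool) : List Cell :=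
  (List.finRange n).map fun X => ⟨q X, st X, mk X, false⟩

/-- The marks after a rule. -/
def updateMarks {n : ℕ} (gr : Bool) (q : Fin n → Bool) (mk : Fin n → Bool)
    (r : Fin n × Config (Fin n)) : Fin n → Bool :=
  let hit := (List.finRange n).any fun Y => decide (r.2 Y ≠ 0) && mk Y
  fun X => if gr then mk X || (decide (X = r.1) && hit)
    else mk X && (!decide (X = r.1) || hit || q X)

theorem runs_rule {n : ℕ} (r : Fin n × Config (Fin n)) (p : ℚ) (q st mk : Fin n → Bool) :
    Runs ((encRule r.1 r.2 p).length + (2 * n + 3))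
      (cfg .rules m z h gr (encRule r.1 r.2 p ++ a) b (cells q st mk) [] g s)
      (cfg .rules .rhs false ((List.finRange n).any fun Y => decide (r.2 Y ≠ 0) && mk Y) gr a
        ((encRule r.1 r.2 p).reverse ++ b) (cells q st (updateMarks gr q mk r)) [] g s) := by
  obtain ⟨X, β⟩ := r
  have h1 := runs_encConfig (m := .lhs) (h := false) (gr := gr) (g := g) (s := s) (b := b)
    (a := encConfig β ++ (encNat p.num.toNat ++ (encNat p.den ++ a))) (Pi.single X 1)
    (fun X => ⟨q X, st X, mk X, false⟩) rfl
  have h2 := h1.trans (runs_encConfig β _ rfl) le_rfl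
  have h3 := h2.trans (runs_skip_encNat p.num.toNat).1 le_rfl
  have h4 := h3.trans (runs_skip_encNat p.den).2 le_rfl
  have h0 : TM2.step program (cfg .rules m z h gr (encRule X β p ++ a) b (cells q st mk) [] g s) =
      some (cfg .scan .lhs false false gr (encConfig (Pi.single X 1) ++
        (encConfig β ++ (encNat p.num.toNat ++ (encNat p.den ++ a)))) b (cells q st mk) [] g s) := by
    rw [encRule, List.append_assoc, List.append_assoc, List.append_assoc]
    exact step_rules_cons Γ'.bra
  refine (Runs.head h0 h4 le_rfl).of_eq ?_ ?_
  · clear h0 h1 h2 h3 h4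
    congr 1
    · simp [encRule, pushRead, afterRewind]
    · have : (Mode.lhs == Mode.rhs) = false := rfl
      refine List.map_congr_left fun Y _ => ?_
      by_cases hY : Y = X <;>
        simp [Cell.set, Cell.update, updateMarks, afterRewind, this, hY]
  · simp only [encRule, List.length_append]
    omega

end Machine

end PBPP
end

/-! ### Rounds, output and total running time -/

noncomputable section

namespace PBPP

namespace Machine

open Computability (Γ')
open Turing

variable {m : Mode} {z h gr : Bool} {a b : List Γ'} {v w : List Cell} {g s : List Unit}

theorem step_readSet_bra :
    TM2.step program (cfg .readSet m z h gr (Γ'.bra :: a) b v w g s) =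
      some (cfg .readSet m z h gr a b v w g s) := by
  simp [cfg, program, State.mk', isBit]
  rfl

theorem runs_restore :
    Runs (b.length + 1) (cfg .restore m z h gr a b v w g s)
      (cfg .round m z h gr (b.reverse ++ a) [] v w g s) := by
  induction b generalizing a with
  | nil =>
    refine Runs.head (t := 0) ?_ (Runs.refl _ _) le_rfl
    simp [cfg, program, State.mk']
  | cons x b ih =>
    have := ih (a := x :: a)
    simp only [List.reverse_cons, List.append_assoc, List.cons_append, List.nil_append] at this ⊢
    refine Runs.head ?_ this le_rfl
    simp [cfg, program, State.mk']

theorem step_round_grow :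
    TM2.step program (cfg .round m z h gr a b v w (() :: g) s) =
      some (cfg .rules .rhs false false true a b v w g s) := by
  simp [cfg, program, State.mk']

theorem step_round_shrink :
    TM2.step program (cfg .round m z h gr a b v w [] (() :: s)) =
      some (cfg .rules .rhs false false false a b v w [] s) := by
  simp [cfg, program, State.mk']

theorem step_round_finish :
    TM2.step program (cfg .round m z h gr a b v w [] []) =
      some (cfg .finish .rhs false false false a b v w [] []) := by
  simp [cfg, program, State.mk']

theorem runs_finish :
    Runs (v.length + 1) (cfg .finish .rhs false h false a b v w g s)
      (cfg .clean .rhs false (h || v.any fun c => c.start && c.mark) false a b [] w g s) := by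
  induction v generalizing h with
  | nil =>
    refine Runs.head (t := 0) ?_ (Runs.refl _ _) le_rfl
    simp [cfg, program, State.mk']
  | cons c v ih =>
    have := ih (h := h || (c.start && c.mark))
    rw [Bool.or_assoc] at this
    refine Runs.head ?_ this le_rfl
    simp [cfg, program, State.mk']

/-- The halting configuration with output `x`. -/
def haltCfg (x : Bool) : TM2.Cfg Alph Label State :=
  ⟨none, .mk' .set false false false,
    Function.update (memory [] [] [] [] [] []) .output [x]⟩

theorem runs_clean :
    Runs (a.length + 1) (cfg .clean m z h gr a [] [] [] [] []) (haltCfg h) := by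
  induction a with
  | nil =>
    refine Runs.head (t := 0) ?_ (Runs.refl _ _) le_rfl
    simp [cfg, program, State.mk', haltCfg]
    rfl
  | cons x a ih =>
    refine Runs.head ?_ ih le_rfl
    simp [cfg, program, State.mk']

section

variable {n : ℕ} (p : Fin n → Config (Fin n) → ℚ) (q st mk : Fin n → Bool)
  (rl : List (Fin n × Config (Fin n)))

/-- The word of a list of rules. -/
def encRules : List Γ' := rl.flatMap fun r => encRule r.1 r.2 (p r.1 r.2)

theorem runs_rules :
    Runs ((encRules p rl).length + rl.length * (2 * n + 3) + 1)
      (cfg .rules m z h gr (encRules p rl) b (cells q st mk) [] g s)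
      (cfg .restore .rhs false false gr [] ((encRules p rl).reverse ++ b)
        (cells q st (rl.foldl (updateMarks gr q) mk)) [] g s) := by
  induction rl generalizing m z h b mk with
  | nil => exact Runs.head (t := 0) step_rules_nil (Runs.refl _ _) (by simp)
  | cons r rl ih =>
    have e : encRules p (r :: rl) = encRule r.1 r.2 (p r.1 r.2) ++ encRules p rl := rfl
    rw [e]
    refine (runs_rule r _ q st mk).trans ((ih _).of_eq ?_ le_rfl) ?_
    · simp
    · simp only [List.length_append, List.length_cons]
      ring_nf
      omega

/-- The time of a round. -/
def roundTime : ℕ := 2 * (encRules p rl).length + rl.length * (2 * n + 3) + 3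

theorem runs_round :
    Runs (2 * (encRules p rl).length + rl.length * (2 * n + 3) + 2)
      (cfg .rules m z h gr (encRules p rl) [] (cells q st mk) [] g s)
      (cfg .round .rhs false false gr (encRules p rl) []
        (cells q st (rl.foldl (updateMarks gr q) mk)) [] g s) := by
  refine (runs_rules p q st mk rl).trans (runs_restore.of_eq ?_ le_rfl) ?_
  · simp
  · simp
    ring_nf
    omega

/-- Stated with an arbitrary continuation `c`, so that the phases can be chained. The continuation
allows any mode and flags because the first round is entered in a different state from the later
ones. -/
theorem runs_grow {c : TM2.Cfg Alph Label State} {t : ℕ} (k : ℕ)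
    (hc : ∀ m z h gr, Runs t (cfg .round m z h gr (encRules p rl) []
      (cells q st ((fun mk => rl.foldl (updateMarks true q) mk)^[k] mk)) [] [] s) c) :
    Runs (k * roundTime p rl + t) (cfg .round m z h gr (encRules p rl) []
      (cells q st mk) [] (List.replicate k ()) s) c := by
  induction k generalizing mk m z h gr with
  | zero => simpa using hc m z h gr
  | succ k ih =>
    refine Runs.head step_round_grow ((runs_round p q st mk rl).trans (ih _ hc) le_rfl) ?_
    rw [roundTime]
    ring_nf
    omega

theorem runs_shrink {c : TM2.Cfg Alph Label State} {t : ℕ} (k : ℕ)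
    (hc : ∀ m z h gr, Runs t (cfg .round m z h gr (encRules p rl) []
      (cells q st ((fun mk => rl.foldl (updateMarks false q) mk)^[k] mk)) [] [] []) c) :
    Runs (k * roundTime p rl + t) (cfg .round m z h gr (encRules p rl) []
      (cells q st mk) [] [] (List.replicate k ())) c := by
  induction k generalizing mk m z h gr with
  | zero => simpa using hc m z h gr
  | succ k ih =>
    refine Runs.head step_round_shrink ((runs_round p q st mk rl).trans (ih _ hc) le_rfl) ?_
    rw [roundTime]
    ring_nf
    omega

/-- The marks of the types that can reach the target. -/
def reachMarks : Fin n → Bool := (fun mk => rl.foldl (updateMarks true q) mk)^[n] q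

/-- The marks of the almost sure types. -/
def finalMarks : Fin n → Bool :=
  (fun mk => rl.foldl (updateMarks false q) mk)^[n] (reachMarks q rl)

theorem runs_main (Q : Finset (Fin n)) (α : Config (Fin n)) :
    Runs (2 * (n * roundTime p rl) + (encConfig α).length + (encRules p rl).length + 4 * n + 7)
      (cfg .readSet .set false false gr (encSet Q ++ encConfig α ++ encRules p rl) [] [] [] [] [])
      (haltCfg ((List.finRange n).any fun X =>
        decide (α X ≠ 0) && finalMarks (fun X => decide (X ∈ Q)) rl X)) := by
  set q : Fin n → Bool := fun X => decide (X ∈ Q) with hq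
  have h0 : TM2.step program (cfg .readSet .set false false gr
      (encSet Q ++ encConfig α ++ encRules p rl) [] [] [] [] []) =
      some (cfg .readSet .set false false gr (((List.finRange n).map q).map Γ'.bit ++
        Γ'.ket :: (encConfig α ++ encRules p rl)) [] [] [] [] []) := by
    rw [encSet]
    simp only [List.append_assoc, List.cons_append, List.nil_append, List.map_map]
    exact step_readSet_bra
  have h1 := Runs.head h0 (runs_readSet _) le_rfl
  have h2 := h1.trans runs_rewind le_rfl
  have h3 := h2.of_eq (c₂ := cfg .scan .start false false gr (encConfig α ++ encRules p rl) []
    ((List.finRange n).map fun X => ⟨q X, false, q X, false⟩) [] (List.replicate n ())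
    (List.replicate n ())) (by simp [Cell.update, afterRewind, Function.comp_def]) le_rfl
  have h4 := h3.trans (runs_encConfig α _ rfl) le_rfl
  have h5 := h4.of_eq (c₂ := cfg .round .start false false gr (encRules p rl) []
    (cells q (fun X => decide (α X ≠ 0)) q) [] (List.replicate n ()) (List.replicate n ()))
    (by
      have e : (Mode.start == Mode.rhs) = false := rfl
      simp [Cell.update, Cell.set, afterRewind, pushRead, cells, e]) le_rfl
  have h6 := h5.trans (runs_grow p q (fun X => decide (α X ≠ 0)) q rl n fun _ _ _ _ =>
    runs_shrink p q (fun X => decide (α X ≠ 0)) _ rl n fun _ _ _ _ =>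
      Runs.head step_round_finish (runs_finish.trans runs_clean le_rfl) le_rfl) le_rfl
  refine h6.of_eq ?_ ?_
  · simp only [cells, List.any_map, Bool.false_or]
    rfl
  · simp only [List.length_reverse, List.length_map, List.length_finRange, List.length_append,
      List.length_nil, cells]
    omega

end

end Machine

end PBPP
end

noncomputable section

namespace PBPP

namespace Machine

open Computability (Γ')
open Turing

/-! ### Correctness of the marks -/

theorem le_foldl {A B : Type*} [Preorder A] {f : A → B → A} (hf : ∀ a b, a ≤ f a b) (l : List B)
    (a : A) : a ≤ l.foldl f a := by
  induction l generalizing a with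
  | nil => exact le_rfl
  | cons b l ih => exact (hf a b).trans (ih _)

/-- An inflationary fold that returns to its start cannot have moved at any step. Thus a stable
round is stable under every single rule, even though rules act in place one after another. -/
theorem eq_of_foldl_eq {A B : Type*} [PartialOrder A] {f : A → B → A} (hf : ∀ a b, a ≤ f a b)
    {l : List B} {a : A} (h : l.foldl f a = a) {b : B} (hb : b ∈ l) : f a b = a := by
  induction l with
  | nil => simp at hb
  | cons c l ih =>
    have hc : f a c = a := le_antisymm ((le_foldl hf l _).trans h.le) (hf a c)
    rw [List.foldl_cons, hc] at h
    rcases List.mem_cons.1 hb with rfl | hb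
    · exact hc
    · exact ih h hb

/-- An increasing map reaches a fixed point as soon as a bounded potential is exhausted. -/
theorem iterate_fixed {A : Type*} {f : A → A} {μ : A → ℕ} {n : ℕ} (hn : ∀ a, μ a ≤ n)
    (hμ : ∀ a, f a ≠ a → μ a < μ (f a)) (a : A) : f (f^[n] a) = f^[n] a := by
  by_contra hne
  have h1 : ∀ k ≤ n, f (f^[k] a) ≠ f^[k] a := by
    intro k hk h
    refine hne ?_
    obtain ⟨j, rfl⟩ := Nat.exists_eq_add_of_le' hk
    have : f^[j] (f^[k] a) = f^[k] a := Function.iterate_fixed h j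
    rw [Function.iterate_add_apply, this, h]
  have h2 : ∀ k ≤ n + 1, k ≤ μ (f^[k] a) := by
    intro k hk
    induction k with
    | zero => exact Nat.zero_le _
    | succ k ih =>
      have := hμ _ (h1 k (by omega))
      rw [Function.iterate_succ_apply']
      have := ih (by omega)
      omega
  have := h2 (n + 1) le_rfl
  have := hn (f^[n + 1] a)
  omega

/-- The number of marked types. -/
def markCount {n : ℕ} (mk : Fin n → Bool) : ℕ := (Finset.univ.filter fun X => mk X = true).card

theorem markCount_le {n : ℕ} (mk : Fin n → Bool) : markCount mk ≤ n :=
  (Finset.card_le_univ _).trans (by simp)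

theorem markCount_lt {n : ℕ} {x y : Fin n → Bool} (hxy : x ≤ y) (hne : y ≠ x) :
    markCount x < markCount y := by
  refine Finset.card_lt_card (Finset.ssubset_iff_subset_ne.2 ⟨fun X hX => ?_, fun h => hne ?_⟩)
  · simp only [Finset.mem_filter, Finset.mem_univ, true_and] at hX ⊢
    exact hxy X hX
  · ext X
    have := Finset.ext_iff.1 h X
    simp only [Finset.mem_filter, Finset.mem_univ, true_and] at this
    exact Bool.eq_iff_iff.2 this.symm

section

variable {n : ℕ} {S : PBPP (Fin n)} {Q : Finset (Fin n)} (rl : List (Fin n × Config (Fin n)))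

theorem le_updateMarks_true (q mk : Fin n → Bool) (r : Fin n × Config (Fin n)) :
    mk ≤ updateMarks true q mk r := by
  intro X h
  simp [updateMarks, h]

theorem updateMarks_false_le (q mk : Fin n → Bool) (r : Fin n × Config (Fin n)) :
    updateMarks false q mk r ≤ mk := by
  intro X h
  simp only [updateMarks, Bool.false_eq_true, if_false, Bool.and_eq_true] at h
  exact h.1

/-- Every round that changes something adds a mark, so `n` rounds suffice. -/
theorem reachMarks_fixed (q : Fin n → Bool) :
    rl.foldl (updateMarks true q) (reachMarks q rl) = reachMarks q rl := by
  refine iterate_fixed (f := fun mk => rl.foldl (updateMarks true q) mk) (μ := markCount)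
    markCount_le (fun mk hmk => ?_) q
  exact markCount_lt (le_foldl (le_updateMarks_true q) rl mk) hmk

theorem finalMarks_fixed (q : Fin n → Bool) :
    rl.foldl (updateMarks false q) (finalMarks q rl) = finalMarks q rl := by
  refine iterate_fixed (f := fun mk => rl.foldl (updateMarks false q) mk)
    (μ := fun mk => n - markCount mk) (fun mk => Nat.sub_le _ _) (fun mk hmk => ?_) _
  have h1 : markCount (rl.foldl (updateMarks false q) mk) < markCount mk :=
    -- Shrinking is inflationary in the dual order.
    markCount_lt (le_foldl (A := (Fin n → Bool)ᵒᵈ) (updateMarks_false_le q) rl mk) (Ne.symm hmk)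
  have h2 := markCount_le mk
  omega

variable {rl}

theorem foldl_invariant {A B : Type*} {f : A → B → A} {l : List B} {P : A → Prop}
    (h : ∀ a, P a → ∀ b ∈ l, P (f a b)) {a : A} (ha : P a) : P (l.foldl f a) := by
  induction l generalizing a with
  | nil => exact ha
  | cons b l ih =>
    exact ih (fun a ha c hc => h a ha c (List.mem_cons_of_mem _ hc))
      (h a ha b List.mem_cons_self)

theorem iterate_invariant {A : Type*} {f : A → A} {P : A → Prop} (h : ∀ a, P a → P (f a))
    {a : A} (ha : P a) (k : ℕ) : P (f^[k] a) := by
  induction k with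
  | zero => exact ha
  | succ k ih => rw [Function.iterate_succ_apply']; exact h _ ih

theorem hit_iff {β : Config (Fin n)} {mk : Fin n → Bool} :
    ((List.finRange n).any fun Y => decide (β Y ≠ 0) && mk Y) = true ↔
      ∃ Y, 1 ≤ β Y ∧ mk Y = true := by
  simp [Nat.one_le_iff_ne_zero]

theorem reachMarks_iff (hrl : ∀ X β, (X, β) ∈ rl ↔ β ∈ S.rules X) (X : Fin n) :
    reachMarks (fun X => decide (X ∈ Q)) rl X = true ↔ CanReach S Q X := by
  constructor
  · refine iterate_invariant (P := fun mk : Fin n → Bool => ∀ X, mk X = true → CanReach S Q X)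
      (fun mk h => foldl_invariant (P := fun mk : Fin n → Bool => ∀ X, mk X = true → CanReach S Q X)
        ?_ h) (fun X hX => CanReach.target (by simpa using hX)) n X
    rintro mk h ⟨Z, β⟩ hr X hX
    simp only [updateMarks, if_true, Bool.or_eq_true, Bool.and_eq_true, decide_eq_true_eq,
      hit_iff] at hX
    obtain hX | ⟨rfl, Y, hY, hm⟩ := hX
    · exact h X hX
    · exact CanReach.step ((hrl _ _).1 hr) hY (h Y hm)
  · intro h
    induction h with
    | @target X hX =>
      refine iterate_invariant (P := fun mk : Fin n → Bool => mk X = true)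
        (fun mk h => le_foldl (le_updateMarks_true _) rl mk X h) ?_ n
      simpa using hX
    | @step X Y β hβ hY _ ih =>
      have := eq_of_foldl_eq (le_updateMarks_true _)
        (reachMarks_fixed rl fun X => decide (X ∈ Q)) ((hrl X β).2 hβ)
      rw [← this]
      simp only [updateMarks, if_true, Bool.or_eq_true, Bool.and_eq_true, decide_eq_true_eq,
        hit_iff]
      exact Or.inr ⟨trivial, Y, hY, ih⟩

/-- The surviving marks can reach `Q` and, being stable, satisfy the closure properties, so they are
almost sure by maximality. Conversely no rule ever removes the mark of an almost sure type, since it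
is a target or the rule spawns another such type. -/
theorem finalMarks_iff (hrl : ∀ X β, (X, β) ∈ rl ↔ β ∈ S.rules X) (X : Fin n) :
    finalMarks (fun X => decide (X ∈ Q)) rl X = true ↔ AlmostSure S Q X := by
  constructor
  · refine almostSure_of_closed
      (V := fun X => finalMarks (fun X => decide (X ∈ Q)) rl X = true) ?_ ?_
    · intro X hX
      rw [← reachMarks_iff hrl]
      revert X
      refine iterate_invariant (P := fun mk : Fin n → Bool => ∀ X, mk X = true →
        reachMarks (fun X => decide (X ∈ Q)) rl X = true) (fun mk h X hX => h X ?_)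
        (fun X hX => hX) n
      exact le_foldl (A := (Fin n → Bool)ᵒᵈ) (updateMarks_false_le _) rl mk X hX
    · intro X hX hQ β hβ
      have := eq_of_foldl_eq (A := (Fin n → Bool)ᵒᵈ) (updateMarks_false_le _)
        (finalMarks_fixed rl fun X => decide (X ∈ Q)) ((hrl X β).2 hβ)
      rw [← this] at hX
      simp only [updateMarks, Bool.false_eq_true, if_false, Bool.and_eq_true, Bool.or_eq_true,
        hit_iff, hQ, decide_true, decide_false, Bool.not_true, false_or, or_false] at hX
      exact hX.2
  · revert X
    refine iterate_invariant (P := fun mk : Fin n → Bool => ∀ X, AlmostSure S Q X → mk X = true)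
      (fun mk h => foldl_invariant
        (P := fun mk : Fin n → Bool => ∀ X, AlmostSure S Q X → mk X = true) ?_ h)
      (fun X hX => (reachMarks_iff hrl X).2 hX.canReach) n
    rintro mk h ⟨Z, β⟩ hr X hX
    simp only [updateMarks, Bool.false_eq_true, if_false, Bool.and_eq_true, Bool.or_eq_true,
      hit_iff, decide_eq_true_eq, Bool.not_eq_true', decide_eq_false_iff_not]
    refine ⟨h X hX, ?_⟩
    by_cases hZ : X = Z
    · subst hZ
      by_cases hQ : X ∈ Q
      · exact Or.inr hQ
      · obtain ⟨Y, hY, hs⟩ := hX.exists_child hQ ((hrl _ _).1 hr)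
        exact Or.inl (Or.inr ⟨Y, hY, h Y hs⟩)
    · exact Or.inl (Or.inl hZ)

end

/-! ### The decision procedure -/

/-- The output of the machine. -/
def answer (I : Instance) : Bool :=
  (List.finRange I.n).any fun X =>
    decide (I.start X ≠ 0) && finalMarks (fun X => decide (X ∈ I.Q)) I.ruleList X

theorem answer_iff (I : Instance) : answer I = true ↔ HasAlmostSure I.S I.Q I.start := by
  rw [answer, hit_iff]
  exact exists_congr fun X => and_congr_right fun _ => finalMarks_iff I.mem_ruleList X

theorem initList_machine (l : Label) (x : List Γ') :
    initList (machine l) x = cfg l .set false false false x [] [] [] [] [] := by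
  unfold initList cfg
  congr 1
  funext k
  cases k <;> rfl

theorem haltList_machine (l : Label) (x : Bool) :
    haltList (machine l) [x] = haltCfg x := by
  unfold haltList haltCfg
  congr 1
  funext k
  cases k <;> rfl

theorem length_le_length_encRules {n : ℕ} (p : Fin n → Config (Fin n) → ℚ)
    (rl : List (Fin n × Config (Fin n))) : rl.length ≤ (encRules p rl).length := by
  induction rl with
  | nil => simp
  | cons r rl ih =>
    have : encRules p (r :: rl) = encRule r.1 r.2 (p r.1 r.2) ++ encRules p rl := rfl
    rw [this, List.length_append, List.length_cons]
    have : 1 ≤ (encRule r.1 r.2 (p r.1 r.2)).length := by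
      simp [encRule, encConfig]
    omega

/-- Here `n`, `r`, `e`, `R`, `L` stand for the number of types, the number of rules, and the lengths
of the initial configuration, of the rules and of the instance. After bounding everything by `L` the
left side is 4L³ + 10L² + 11L + 7, so the constant 16 is generous. -/
theorem time_le {n r e R L : ℕ} (hn : n ≤ L) (hr : r ≤ R) (hL : e + R ≤ L) :
    2 * (n * (2 * R + r * (2 * n + 3) + 3)) + e + R + 4 * n + 7 ≤ 16 * (L + 1) ^ 3 := by
  have hR : R ≤ L := by omega
  have hr' : r ≤ L := hr.trans hR
  calc 2 * (n * (2 * R + r * (2 * n + 3) + 3)) + e + R + 4 * n + 7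
      ≤ 2 * (L * (2 * L + L * (2 * L + 3) + 3)) + L + 4 * L + 7 := by
        have : n * (2 * R + r * (2 * n + 3) + 3) ≤ L * (2 * L + L * (2 * L + 3) + 3) := by gcongr
        omega
    _ ≤ 16 * (L + 1) ^ 3 := by ring_nf; nlinarith [Nat.zero_le L]

theorem runs_instance (I : Instance) (gr : Bool) :
    Runs (16 * ((encInstance I).length + 1) ^ 3)
      (cfg .readSet .set false false gr (encInstance I) [] [] [] [] []) (haltCfg (answer I)) := by
  refine (runs_main I.S.prob I.ruleList I.Q I.start).of_eq rfl (time_le ?_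
    (length_le_length_encRules I.S.prob I.ruleList) ?_)
  · simp [encInstance, encSet]
    omega
  · simp only [encInstance, encRules, List.length_append]
    omega

theorem decidableInPolyTime_of_runs {A : Type} (enc : A → List Γ') (p : A → Prop) (f : A → Bool)
    (hf : ∀ x, f x = true ↔ p x) (l : Label)
    (h : ∀ x, Runs (16 * ((enc x).length + 1) ^ 3)
      (cfg l .set false false false (enc x) [] [] [] [] []) (haltCfg (f x))) :
    DecidableInPolyTime enc p := by
  refine ⟨f, hf, ⟨⟨⟨machine l, Equiv.refl _, Equiv.refl _⟩, 16 * (Polynomial.X + 1) ^ 3,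
    fun x => ?_⟩⟩⟩
  choose n hn e using h
  refine ⟨⟨n x, ?_⟩, ?_⟩
  · have h1 : List.map (Equiv.refl Γ').invFun (enc x) = enc x := List.map_id _
    have h2 : List.map (Equiv.refl Bool).invFun (Computability.encodeBool (f x)) = [f x] := rfl
    have := e x
    rw [← initList_machine, ← haltList_machine l] at this
    erw [h1, h2]
    exact this
  · simpa using hn x

theorem decidableInPolyTime_instance (p : Instance → Prop)
    (hp : ∀ I, HasAlmostSure I.S I.Q I.start ↔ p I) : DecidableInPolyTime encInstance p :=
  decidableInPolyTime_of_runs _ p answer (fun I => (answer_iff I).trans (hp I)) .readSet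
    fun I => runs_instance I false

theorem decidableInPolyTime_fairInstance (p : FairInstance → Prop)
    (hp : ∀ I, HasAlmostSure I.S I.Q I.start ↔ p I) : DecidableInPolyTime encFairInstance p := by
  refine decidableInPolyTime_of_runs _ p (fun I => answer I.toInstance)
    (fun I => (answer_iff _).trans (hp I)) .bound fun I => ?_
  -- The answer does not depend on `k`, so the machine skips it and then behaves as before.
  have h1 := (runs_bound (m := .set) (z := false) (h := false) (gr := false)
    (a := encInstance I.toInstance) (b := []) (v := []) (w := []) (g := []) (s := [])
    (Computability.encodeNat I.k)).trans (runs_instance I.toInstance false) le_rfl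
  have e : encFairInstance I = (Computability.encodeNat I.k).map Γ'.bit ++
      Γ'.comma :: encInstance I.toInstance := by
    simp [encFairInstance, encNat]
  rw [e]
  refine h1.of_eq rfl ?_
  simp only [List.length_append, List.length_map, List.length_cons]
  generalize (Computability.encodeNat I.k).length = x
  generalize (encInstance I.toInstance).length = y
  -- The linear cost of skipping `k` fits into the cubic bound for the longer input.
  have : (x + (y + 1) + 1) ^ 3 ≥ (y + 1) ^ 3 + (x + 1) := by
    have h3 : x + (y + 1) + 1 = (y + 1) + (x + 1) := by ring
    rw [h3]
    have h4 : (x + 1) ≤ (x + 1) ^ 3 := Nat.le_self_pow (by norm_num) _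
    have h5 := Nat.zero_le ((y + 1) ^ 2 * (x + 1))
    have h6 := Nat.zero_le ((y + 1) * (x + 1) ^ 2)
    nlinarith
  omega

end Machine

end PBPP
end

theorem mainTheorem6 :
    -- almost-sure coverability in either Markov chain is decidable in polynomial time
    (PBPP.DecidableInPolyTime PBPP.encInstance
        (fun I => I.S.probType I.start (PBPP.qStates I.Q) = 1) ∧
      PBPP.DecidableInPolyTime PBPP.encInstance
        (fun I => I.S.probProc I.start (PBPP.qStates I.Q) = 1)) ∧
    -- the Markov chain, the existential and the fair universal questions coincide
    (∀ (Γ : Type u) [Fintype Γ] [DecidableEq Γ] (S : PBPP Γ) (Q : Finset Γ)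
        (α₀ : PBPP.Config Γ) (k : ℕ), Fintype.card Γ ≤ k →
      List.TFAE [
        S.probType α₀ (PBPP.qStates Q) = 1,
        S.probProc α₀ (PBPP.qStates Q) = 1,
        ∃ σ : S.mdp.Scheduler, σ.prob α₀ (PBPP.qStates Q) = 1,
        ∀ σ : S.mdp.Scheduler, PBPP.FairScheduler k σ → σ.prob α₀ (PBPP.qStates Q) = 1]) ∧
    -- hence the existential and the fair universal problems are decidable in polynomial time
    PBPP.DecidableInPolyTime PBPP.encInstance
      (fun I => ∃ σ : I.S.mdp.Scheduler, σ.prob I.start (PBPP.qStates I.Q) = 1) ∧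
    PBPP.DecidableInPolyTime PBPP.encFairInstance
      (fun I => ∀ σ : I.S.mdp.Scheduler, PBPP.FairScheduler I.k σ →
        σ.prob I.start (PBPP.qStates I.Q) = 1) := by
  have dec := PBPP.Machine.decidableInPolyTime_instance
  have decFair := PBPP.Machine.decidableInPolyTime_fairInstance
  refine ⟨⟨dec _ fun I => ?_, dec _ fun I => ?_⟩, ?_, dec _ fun I => ?_, decFair _ fun I => ?_⟩
  -- Only the fair universal condition involves `k`, so here `k` may be taken to be the number of
  -- types.
  · exact (PBPP.tfae_almostSure I.S I.Q I.start le_rfl).out 0 1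
  · exact (PBPP.tfae_almostSure I.S I.Q I.start le_rfl).out 0 2
  · intro Γ _ _ S Q α₀ k hk
    exact List.tfae_cons_cons.1 (PBPP.tfae_almostSure S Q α₀ hk) |>.2
  · exact (PBPP.tfae_almostSure I.S I.Q I.start le_rfl).out 0 3
  · exact (PBPP.tfae_almostSure I.S I.Q I.start (by simpa using I.le_k)).out 0 4
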